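/- All graphs are finite, connected, undirected, without loops or multiple edges; $d$ denotes the shortest-path distance, $I(u,v)=\{x : d(u,x)+d(x,v)=d(u,v)\}$ the metric interval, and $e(v)=\max_u d(u,v)$ the eccentricity; a vertex is central if its eccentricity is minimum among all vertices. A graph is $(\alpha_1,\Delta)$-metric if (i) for all vertices $u,v,w,x$ such that $v\in I(u,w)$ and $w\in I(v,x)$ are adjacent, $d(u,x)\ge d(u,v)+1+d(w,x)-1$, and (ii) for all vertices $u,v,w$ such that $u,v$ are adjacent and $d(u,w)=d(v,w)=k$, there is a common neighbour $x$ of $u$ and $v$ with $d(x,w)=k-1$. The machine is a unit-cost random access machine on natural numbers with registers, indirectly addressed arrays, addition, truncated subtraction and tests for being nonzero. The input is a graph with vertices $0,\dots,n-1$ and $m$ edges, given by $n$ and by its adjacency lists (in arbitrary order, stored consecutively in an array, together with the array of the starting positions of the lists). Theorem. There are a program $P$ and a constant $C$ such that, for every $(\alpha_1,\Delta)$-metric graph $G$ with $m$ edges and for every adjacency-list representation of $G$, the program $P$ halts after at most $C(m+1)$ steps and outputs a central vertex of $G$, and all numbers (including addresses) that occur in the computation are at most $C(m+1)$, i.e.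 they fit into words of $O(\log (m+2))$ bits. In particular, a central vertex of an $m$-edge $(\alpha_1,\Delta)$-metric graph can be computed in $O(m)$ time. -/

import Mathlib

/-! ## Metric graph classes -/

namespace SimpleGraph

variable {V : Type*}

/-- The metric interval between `u` and `v`: all vertices lying on shortest paths from `u` to `v`
(for a connected graph). -/
def interval (G : SimpleGraph V) (u v : V) : Set V :=
  {x | G.dist u x + G.dist x v = G.dist u v}

/-- The metric property `α_i`: if `v ∈ I(u,w)` and `w ∈ I(v,x)` are adjacent, then
`d(u,x) ≥ d(u,v) + 1 + d(w,x) - i`. -/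
def IsAlphaMetric (G : SimpleGraph V) (i : ℕ) : Prop :=
  ∀ u v w x : V, G.Adj v w → v ∈ G.interval u w → w ∈ G.interval v x →
    G.dist u v + 1 + G.dist w x ≤ G.dist u x + i

/-- The triangle condition: if `u` and `v` are adjacent and `d(u,w) = d(v,w) = k`, then they have
a common neighbour `x` with `d(x,w) = k - 1`. -/
def TriangleCondition (G : SimpleGraph V) : Prop :=
  ∀ (u v w : V) (k : ℕ), G.Adj u v → G.dist u w = k → G.dist v w = k →
    ∃ x, G.Adj u x ∧ G.Adj v x ∧ G.dist x w + 1 = k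

/-- `(α₁, Δ)`-metric graphs: connected graphs with the `α₁`-metric property and the triangle
condition. -/
structure IsAlphaOneDeltaMetric (G : SimpleGraph V) : Prop where
  connected : G.Connected
  alpha : G.IsAlphaMetric 1
  triangle : G.TriangleCondition

end SimpleGraph

/-! ## A unit-cost random access machine with bounded words

The machine has registers `reg 0, reg 1, …` and arrays `mem 0, mem 1, …` of natural numbers, each
array being indexed by natural numbers (indirect addressing).  A program is a finite text, so it
names only finitely many registers and arrays.  Every constant, register access, array access,
addition, (truncated) subtraction, assignment, and test costs one step.  All numbers that a
computation touches have to be at most the word bound `W`: a computation that would exceed it is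
stuck and has no execution. -/

namespace RAM

/-- The memory contents of the machine. -/
structure State where
  reg : ℕ → ℕ
  mem : ℕ → ℕ → ℕ

/-- Writing to a register. -/
def State.setReg (s : State) (r v : ℕ) : State :=
  { s with reg := Function.update s.reg r v }

/-- Writing to the cell `i` of the array `a`. -/
def State.setMem (s : State) (a i v : ℕ) : State :=
  { s with mem := Function.update s.mem a (Function.update (s.mem a) i v) }

/-- Arithmetic expressions; `load a e` reads the cell of the array `a` whose index is the value
of `e`. -/
inductive Expr where
  | const (k : ℕ)
  | reg (r : ℕ)
  | load (a : ℕ) (e : Expr)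
  | add (e f : Expr)
  | sub (e f : Expr)

/-- The value of an expression. -/
def Expr.eval (s : State) : Expr → ℕ
  | const k => k
  | reg r => s.reg r
  | load a e => s.mem a (e.eval s)
  | add e f => e.eval s + f.eval s
  | sub e f => e.eval s - f.eval s

/-- The number of elementary steps needed to evaluate an expression. -/
def Expr.cost : Expr → ℕ
  | const _ => 1
  | reg _ => 1
  | load _ e => e.cost + 1
  | add e f => e.cost + f.cost + 1
  | sub e f => e.cost + f.cost + 1

/-- All values that occur in the evaluation of an expression, including the addresses, are at most
`W`. -/
def Expr.Fits (W : ℕ) (s : State) : Expr → Prop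
  | const k => k ≤ W
  | reg r => s.reg r ≤ W
  | load a e => e.Fits W s ∧ s.mem a (e.eval s) ≤ W
  | add e f => e.Fits W s ∧ f.Fits W s ∧ e.eval s + f.eval s ≤ W
  | sub e f => e.Fits W s ∧ f.Fits W s

/-- Programs. `assign r e` writes the value of `e` to the register `r`, `store a e f` writes the
value of `f` to the cell of the array `a` whose index is the value of `e`; tests ask whether
the value of an expression is nonzero. -/
inductive Program where
  | skip
  | assign (r : ℕ) (e : Expr)
  | store (a : ℕ) (e f : Expr)
  | seq (p q : Program)
  | ifNonzero (e : Expr) (p q : Program)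
  | whileNonzero (e : Expr) (p : Program)

/-- `Exec W p s t s'`: with word bound `W`, the program `p` started in the state `s` halts after
exactly `t` elementary steps in the state `s'`, no number exceeding `W` on the way. -/
inductive Exec (W : ℕ) : Program → State → ℕ → State → Prop where
  | skip (s : State) : Exec W Program.skip s 1 s
  | assign (s : State) (r : ℕ) (e : Expr) (he : e.Fits W s) :
      Exec W (Program.assign r e) s (e.cost + 1) (s.setReg r (e.eval s))
  | store (s : State) (a : ℕ) (e f : Expr) (he : e.Fits W s) (hf : f.Fits W s) :
      Exec W (Program.store a e f) s (e.cost + f.cost + 1) (s.setMem a (e.eval s) (f.eval s))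
  | seq {p q : Program} {s₁ s₂ s₃ : State} {t₁ t₂ : ℕ}
      (hp : Exec W p s₁ t₁ s₂) (hq : Exec W q s₂ t₂ s₃) :
      Exec W (Program.seq p q) s₁ (t₁ + t₂) s₃
  | ifTrue {e : Expr} {p q : Program} {s₁ s₂ : State} {t : ℕ}
      (he : e.Fits W s₁) (h : e.eval s₁ ≠ 0) (hp : Exec W p s₁ t s₂) :
      Exec W (Program.ifNonzero e p q) s₁ (e.cost + 1 + t) s₂
  | ifFalse {e : Expr} {p q : Program} {s₁ s₂ : State} {t : ℕ}
      (he : e.Fits W s₁) (h : e.eval s₁ = 0) (hq : Exec W q s₁ t s₂) :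
      Exec W (Program.ifNonzero e p q) s₁ (e.cost + 1 + t) s₂
  | whileTrue {e : Expr} {p : Program} {s₁ s₂ s₃ : State} {t₁ t₂ : ℕ}
      (he : e.Fits W s₁) (h : e.eval s₁ ≠ 0) (hp : Exec W p s₁ t₁ s₂)
      (hw : Exec W (Program.whileNonzero e p) s₂ t₂ s₃) :
      Exec W (Program.whileNonzero e p) s₁ (e.cost + 1 + t₁ + t₂) s₃
  | whileFalse {e : Expr} {p : Program} {s : State}
      (he : e.Fits W s) (h : e.eval s = 0) :
      Exec W (Program.whileNonzero e p) s (e.cost + 1) s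

end RAM

/-! ## Graphs as inputs -/

/-- `adj` is an adjacency list representation of the graph `G` on the vertices `0, …, n - 1`:
`adj v` lists the neighbours of `v` without repetition, in an arbitrary order. -/
def IsAdjacencyLists {n : ℕ} (G : SimpleGraph (Fin n)) (adj : Fin n → List (Fin n)) : Prop :=
  ∀ v, (adj v).Nodup ∧ ∀ u, u ∈ adj v ↔ G.Adj v u

/-- The initial state of the machine for an input given by adjacency lists: the register `0` holds
the number `n` of vertices, the array `1` holds the concatenation of the lists of the vertices
`0, …, n - 1`, and the cell `i` of the array `0`, for `i ≤ n`, holds the total length of the lists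
of the vertices smaller than `i`, so that the list of `v` occupies the cells of the array `1` from
the index `mem 0 v` on and before the index `mem 0 (v + 1)`.  Everything else is `0`. -/
def inputState {n : ℕ} (adj : Fin n → List (Fin n)) : RAM.State where
  reg r := if r = 0 then n else 0
  mem a i :=
    if a = 0 then
      if i ≤ n then (((List.finRange n).take i).map fun v => (adj v).length).sum else 0
    else if a = 1 then
      (((List.finRange n).flatMap adj).map fun v => (v : ℕ)).getD i 0
    else 0

/-! ## Metric properties of `(α₁, Δ)`-metric graphs -/

namespace SimpleGraph

section Connected

variable {V : Type*} {G : SimpleGraph V}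

/-! Let R be the radius. The algorithm finds a vertex of eccentricity at most R + 3, makes a bounded
number of descent steps from it, and returns the best vertex met.

Start. Let z be farthest from an arbitrary vertex p, let D be the eccentricity of z, and let m lie
on a geodesic from z to p at distance ⌈D/2⌉ from z. If some y were too far from m compared with its
distances to z and to p, the first three steps of a geodesic from m to y would stay in one slice of
the interval. But slices have diameter at most two (`not_geodesic_in_slice`,
`dist_add_dist_le_of_mem_interval`). With D ≤ 2R this bounds the eccentricity of m by R + 3
(`eccLE_of_midpoint`).

Descent. Suppose that p has eccentricity r + 1 and that some vertex has eccentricity at most r; then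
one such vertex lies within distance two of p (`exists_eccLE_dist_le_two`). Fix z farthest from p.
Among the neighbours of p one step nearer to z, let q have the most vertices within distance r. If
some neighbour c of p has eccentricity at most r, then c is a candidate with full count, so q has
full count too (`eccLE_of_isDescent_of_adj`). Otherwise q is adjacent to a vertex of eccentricity at
most r (`adj_of_maximal`, the heart of the geometry), and the next step falls under the first case.
So two steps gain one unit of eccentricity, and six steps gain the three units needed
(`exists_eccLE_of_descents`).

Linear time. The candidates for q form a clique K. A vertex at distance `lev y` from K is at
distance `lev y` or `lev y + 1` from each member of K, so the counts differ only through the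
vertices y of level r: what matters is whether u is a member nearest to y. The members nearest to y
are exactly the neighbours in K of a single vertex, a gate of y. Gates travel outwards in
breadth-first order: each vertex inherits from the inner neighbour with the largest projection
(`exists_projCard_le`, `isGate_of_projCard_le`). Counting the level-r vertices per gate and summing
over each adjacency list then compares all candidates at once (`sum_card_filter_gate`,
`nearCard_le_nearCard`). Each pass takes time linear in the numbers of vertices and edges
(`runs_scan`), and connectedness bounds the former by the latter plus one. -/

theorem Connected.exists_adj_dist_eq (hc : G.Connected) {u v : V} {k : ℕ}
    (h : G.dist u v = k + 1) : ∃ w, G.Adj u w ∧ G.dist w v = k := by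
  obtain ⟨p, hp⟩ := hc.exists_walk_length_eq_dist u v
  cases p with
  | nil => simp at h
  | @cons _ w _ ha q =>
    refine ⟨w, ha, ?_⟩
    have h1 := G.dist_le q
    have h2 := hc.dist_triangle (u := u) (v := w) (w := v)
    rw [dist_eq_one_iff_adj.2 ha] at h2
    simp only [Walk.length_cons] at hp
    omega

theorem Connected.dist_le_dist_add_one (hc : G.Connected) {u v : V} (h : G.Adj u v) (w : V) :
    G.dist u w ≤ G.dist v w + 1 := by
  have h2 := hc.dist_triangle (u := u) (v := v) (w := w)
  rw [dist_eq_one_iff_adj.2 h] at h2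
  omega

theorem Connected.exists_dist_eq_dist_add (hc : G.Connected) {u v : V} (j : ℕ)
    (h : j ≤ G.dist u v) : ∃ w, G.dist u w = j ∧ G.dist u w + G.dist w v = G.dist u v := by
  induction j with
  | zero => exact ⟨u, by simp, by simp⟩
  | succ j ih =>
    obtain ⟨w, hw, hwv⟩ := ih (by omega)
    obtain ⟨x, hx, hxv⟩ :=
      hc.exists_adj_dist_eq (u := w) (v := v) (k := G.dist u v - j - 1) (by omega)
    have h1 := hc.dist_le_dist_add_one hx.symm u
    have h2 := hc.dist_triangle (u := u) (v := x) (w := v)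
    rw [G.dist_comm (u := x), G.dist_comm (u := w)] at h1
    exact ⟨x, by omega, by omega⟩

end Connected

variable {V : Type*}

/-- All vertices are at distance at most `r` from `v`. -/
def EccLE (G : SimpleGraph V) (v : V) (r : ℕ) : Prop := ∀ y, G.dist v y ≤ r

/-- The number of vertices nearer to `u` than `k`. -/
noncomputable def nearCard (G : SimpleGraph V) (u : V) (k : ℕ) : ℕ := {y | G.dist u y < k}.ncard

/-- `q` is a neighbour of `p` on the way to some vertex `z` farthest from `p`, and among all such
neighbours it has the largest number of vertices nearer than the eccentricity of `p`. -/
def IsDescent (G : SimpleGraph V) (p q : V) : Prop :=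
  ∃ z, (∀ y, G.dist p y ≤ G.dist p z) ∧ G.Adj p q ∧ G.dist q z + 1 = G.dist p z ∧
    ∀ u, G.Adj p u → G.dist u z + 1 = G.dist p z →
      G.nearCard u (G.dist p z) ≤ G.nearCard q (G.dist p z)

/-! ### Local consequences of the α₁ and triangle conditions. -/

namespace IsAlphaOneDeltaMetric

variable {G : SimpleGraph V} (hG : G.IsAlphaOneDeltaMetric)
include hG

/-- The working form of α₁: two geodesics glued along a common edge `v w` give a walk at most one
longer than a geodesic. -/
theorem dist_add_dist_le {u v w x : V} (h : G.Adj v w) (h1 : G.dist u w = G.dist u v + 1)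
    (h2 : G.dist v x = G.dist w x + 1) : G.dist u v + G.dist w x ≤ G.dist u x := by
  have hvw := dist_eq_one_iff_adj.2 h
  have := hG.alpha u v w x h (by simp [interval]; omega) (by simp [interval]; omega)
  omega

/-- If `a` and `b` were at distance two, gluing the path `a x b` to a geodesic from `x` through `b`
to `z` would force `d(a,z) ≥ k + 1`. -/
theorem eq_or_adj_of_adj_of_adj {a b x z : V} {k : ℕ} (ha : G.Adj x a) (hb : G.Adj x b)
    (hx : G.dist x z = k + 1) (haz : G.dist a z = k) (hbz : G.dist b z = k) :
    a = b ∨ G.Adj a b := by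
  by_contra! hn
  have h1 := hG.connected.one_lt_dist_of_ne_of_not_adj hn.1 hn.2
  have hax := dist_eq_one_iff_adj.2 ha.symm
  have h2 := hG.connected.dist_le_dist_add_one ha.symm b
  rw [dist_eq_one_iff_adj.2 hb] at h2
  have := hG.dist_add_dist_le (u := a) (v := x) (w := b) (x := z) hb (by omega) (by omega)
  omega

/-- `b` and `d` are both neighbours of `a` one step nearer to `c`. Hence induced four-cycles do not
exist. -/
theorem adj_of_four_cycle {a b c d : V} (hab : G.Adj a b) (hbc : G.Adj b c) (hcd : G.Adj c d)
    (hda : G.Adj d a) (hac : ¬ G.Adj a c) (hbd : b ≠ d) (hac' : a ≠ c) : G.Adj b d := by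
  have h1 := hG.connected.one_lt_dist_of_ne_of_not_adj hac' hac
  have h2 := hG.connected.dist_le_dist_add_one hab c
  have h3 := dist_eq_one_iff_adj.2 hbc
  have h4 := dist_eq_one_iff_adj.2 hcd.symm
  rcases hG.eq_or_adj_of_adj_of_adj (z := c) (k := 1) hab hda.symm (by omega) h3 h4 with h | h
  · exact absurd h hbd
  · exact h

theorem exists_common_neighbor {u v w : V} {k : ℕ} (h : G.Adj u v) (hu : G.dist u w = k + 1)
    (hv : G.dist v w = k + 1) : ∃ x, G.Adj u x ∧ G.Adj v x ∧ G.dist x w = k := by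
  obtain ⟨x, h1, h2, h3⟩ := hG.triangle u v w (k + 1) h hu hv
  exact ⟨x, h1, h2, by omega⟩

/-- Induction on the clique. If the new vertex `y` misses the old common neighbour `p`, the triangle
condition for `y` and one old `x` gives `q`, adjacent to `p`. In each four-cycle `y q p u` the
diagonal `y p` is absent, so `q u` is present. -/
theorem exists_common_neighbor_of_clique (z : V) (k : ℕ) (K : Finset V) (hne : K.Nonempty)
    (hK : ∀ u ∈ K, ∀ v ∈ K, u ≠ v → G.Adj u v) (hz : ∀ u ∈ K, G.dist u z = k + 1) :
    ∃ g, G.dist g z = k ∧ ∀ u ∈ K, G.Adj u g := by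
  classical
  induction hne using Finset.Nonempty.cons_induction with
  | singleton a =>
    obtain ⟨g, h1, h2⟩ := hG.connected.exists_adj_dist_eq (hz a (by simp))
    exact ⟨g, h2, by simpa using h1⟩
  | cons y K hy hne ih =>
    obtain ⟨p, hp, hpK⟩ := ih
      (fun u hu v hv => hK u (Finset.mem_cons_of_mem hu) v (Finset.mem_cons_of_mem hv))
      (fun u hu => hz u (Finset.mem_cons_of_mem hu))
    by_cases hyp : G.Adj y p
    · exact ⟨p, hp, by simpa [hyp] using hpK⟩
    have hyK : ∀ u ∈ K, G.Adj y u := fun u hu =>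
      hK y (by simp) u (Finset.mem_cons_of_mem hu) (by rintro rfl; exact hy hu)
    have hzy := hz y (by simp)
    obtain ⟨x, hx⟩ := hne
    obtain ⟨q, hxq, hyq, hq⟩ :=
      hG.exists_common_neighbor (hyK x hx).symm (hz x (Finset.mem_cons_of_mem hx)) hzy
    have hpq : G.Adj p q := by
      rcases hG.eq_or_adj_of_adj_of_adj (hpK x hx) hxq (hz x (Finset.mem_cons_of_mem hx)) hp hq
        with rfl | h
      · exact absurd hyq hyp
      · exact h
    refine ⟨q, hq, ?_⟩
    intro u hu
    rcases Finset.mem_cons.1 hu with rfl | hu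
    · exact hyq
    · have huz := hz u (Finset.mem_cons_of_mem hu)
      exact (hG.adj_of_four_cycle hyq hpq.symm (hpK u hu).symm (hyK u hu).symm hyp
        (by rintro rfl; omega) (by rintro rfl; omega)).symm

/-- Take `c` as near to `p` as possible. The next vertex `t` towards `p` has some `y` at distance `r
+ 1`, with `d(c,y) = r`; gluing along `t c` gives `d(p,y) ≥ d(p,t) + r`, so `d(p,t) ≤ 1`. -/
theorem exists_eccLE_dist_le_two {p c : V} {r : ℕ} (hp : G.EccLE p (r + 1)) (hc : G.EccLE c r) :
    ∃ c, G.EccLE c r ∧ G.dist p c ≤ 2 := by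
  classical
  have hex : ∃ l, ∃ c, G.EccLE c r ∧ G.dist p c = l := ⟨_, c, hc, rfl⟩
  obtain ⟨c, hc, hl⟩ := Nat.find_spec hex
  refine ⟨c, hc, ?_⟩
  by_contra! hlt
  obtain ⟨l, hl'⟩ : ∃ l, G.dist c p = l + 1 := ⟨G.dist c p - 1, by rw [dist_comm]; omega⟩
  obtain ⟨t, hct, ht⟩ := hG.connected.exists_adj_dist_eq hl'
  have ht' : ¬ G.EccLE t r := fun h =>
    Nat.find_min hex (m := l) (by rw [← hl, dist_comm]; omega) ⟨t, h, by rw [dist_comm]; exact ht⟩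
  simp only [EccLE, not_forall, not_le] at ht'
  obtain ⟨y, hy⟩ := ht'
  have h1 := hc y
  have h2 := hG.connected.dist_le_dist_add_one hct.symm y
  have h3 := hp y
  rw [dist_comm] at hl' ht
  have := hG.dist_add_dist_le (u := p) (v := t) (w := c) (x := y) hct.symm (by omega) (by omega)
  omega

/-! ### The descent step when no neighbour of `p` has eccentricity at most `r`. -/

section Descent

variable {p c : V} {r : ℕ} (hp : G.EccLE p (r + 1)) (hc : G.EccLE c r) (hpc : G.dist p c = 2)
  (hno : ∀ c, G.Adj p c → ¬ G.EccLE c r)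
include hp hc hpc hno

omit hpc hno hp in
theorem dist_eq_of_adj_eccLE {t y : V} (htc : G.Adj t c) (hy : r < G.dist t y) :
    G.dist t y = r + 1 ∧ G.dist c y = r := by
  have h1 := hc y
  have h2 := hG.connected.dist_le_dist_add_one htc y
  omega

omit hno in
theorem dist_eq_of_far {t y : V} (hpt : G.Adj p t) (htc : G.Adj t c) (hy : r < G.dist t y) :
    G.dist p y = r + 1 := by
  have ⟨h1, h2⟩ := hG.dist_eq_of_adj_eccLE hc htc hy
  have h3 := hp y
  have h4 := dist_eq_one_iff_adj.2 hpt
  have := hG.dist_add_dist_le (u := p) (v := t) (w := c) (x := y) htc (by omega) (by omega)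
  omega

omit hp in
-- If a middle vertex `t` is too far from `y`, the triangle condition for `p` and `t` repairs it:
-- the common neighbour `s` and `c` are both one step from `t` towards `y`, hence adjacent.
theorem exists_mid_dist_eq {y : V} (hy : G.dist p y = r + 1) :
    ∃ t, G.Adj p t ∧ G.Adj t c ∧ G.dist t y = r := by
  obtain ⟨t, hpt, htc⟩ := hG.connected.exists_adj_dist_eq (u := p) (v := c) (k := 1) hpc
  rw [dist_eq_one_iff_adj] at htc
  have hpt' := hG.connected.dist_le_dist_add_one hpt y
  rcases Nat.lt_or_ge r (G.dist t y) with h | h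
  · have ⟨h1, h2⟩ := hG.dist_eq_of_adj_eccLE hc htc h
    obtain ⟨s, hps, hts, hs⟩ := hG.exists_common_neighbor hpt hy h1
    rcases hG.eq_or_adj_of_adj_of_adj hts htc h1 hs h2 with rfl | hsc
    · exact absurd hc (hno _ hps)
    · exact ⟨s, hps, hsc, hs⟩
  · exact ⟨t, hpt, htc, by omega⟩

omit hp hpc in
-- If `u` were near `y`, then `u` and `c` would both be neighbours of `t` one step nearer to `y`,
-- hence equal or adjacent.
theorem far_of_far {t u y : V} (hpu : G.Adj p u) (htc : G.Adj t c)
    (hut : G.Adj t u) (huc : ¬ G.Adj u c) (hy : r < G.dist t y) : r < G.dist u y := by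
  have ⟨h1, h2⟩ := hG.dist_eq_of_adj_eccLE hc htc hy
  by_contra! h
  have h3 := hG.connected.dist_le_dist_add_one hut y
  rcases hG.eq_or_adj_of_adj_of_adj hut htc h1 (by omega) h2 with rfl | h
  · exact hno _ hpu hc
  · exact huc h

/-- Argue by contradiction. If `u` misses `c`, maximality makes `u` and every middle vertex on the
way to `z` far from the same vertices. A vertex `y` far from both then leads to a middle vertex `g`
that is adjacent to `u` and near `y`, and `g` can be neither near `z` nor far from it. -/
theorem adj_of_maximal [Finite V] {z u : V} (hz : G.dist p z = r + 1) (hpu : G.Adj p u)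
    (huz : G.dist u z = r)
    (hmax : ∀ t, G.Adj p t → G.dist t z = r → G.nearCard t (r + 1) ≤ G.nearCard u (r + 1)) :
    G.Adj u c := by
  by_contra huc
  have hA : ∀ {t y : V}, G.Adj t c → G.Adj t u → r < G.dist t y → r < G.dist u y :=
    fun htc hut hy => hG.far_of_far hc hno hpu htc hut huc hy
  have hne : ∀ t, G.Adj p t → t ≠ c := by
    rintro t ht rfl
    exact hno _ ht hc
  -- By `hA` the vertices near `u` are among those near `t`; maximality of `u` turns the inclusion
  -- into equality.
  have hB : ∀ t y, G.Adj p t → G.Adj t c → G.dist t z = r → r < G.dist u y → r < G.dist t y := by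
    intro t y hpt htc htz hy
    rcases hG.eq_or_adj_of_adj_of_adj hpt hpu hz htz huz with rfl | hut
    · exact hy
    have hsub : {y | G.dist u y < r + 1} ⊆ {y | G.dist t y < r + 1} := by
      intro y hy
      simp only [Set.mem_ofPred_eq] at hy ⊢
      by_contra! h
      have := hA htc hut (y := y) (by omega)
      omega
    have heq := Set.eq_of_subset_of_ncard_le hsub (hmax t hpt htz) (Set.toFinite _)
    by_contra! h
    have : y ∈ {y | G.dist t y < r + 1} := by simp only [Set.mem_ofPred_eq]; omega
    rw [← heq] at this
    simp only [Set.mem_ofPred_eq] at this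
    omega
  obtain ⟨t, hpt, htc, htz⟩ := hG.exists_mid_dist_eq hc hpc hno hz
  have hut : G.Adj t u := by
    rcases hG.eq_or_adj_of_adj_of_adj hpt hpu hz htz huz with rfl | h
    · exact absurd htc huc
    · exact h
  have ht := hno t hpt
  simp only [EccLE, not_forall, not_le] at ht
  obtain ⟨y, hy⟩ := ht
  have ⟨hty, hcy⟩ := hG.dist_eq_of_adj_eccLE hc htc hy
  have hpy := hG.dist_eq_of_far hp hc hpc hpt htc hy
  have huy := hA htc hut hy
  obtain ⟨s, hps, hsc, hsy⟩ := hG.exists_mid_dist_eq hc hpc hno hpy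
  have hsz : r < G.dist s z := by
    by_contra! h
    have := hG.connected.dist_le_dist_add_one hps z
    have := hB s y hps hsc (by omega) huy
    omega
  have hus : ¬ G.Adj s u := fun h => by
    have := hA hsc h hsz
    omega
  -- At distance `r + 2`, gluing along `p u` would give `d(y,z) ≥ 2r + 1`, whereas the detour
  -- through `c` has length at most `2r`.
  have huy' : G.dist u y = r + 1 := by
    have h1 := hG.connected.dist_le_dist_add_one hut.symm y
    have h2 := hp y
    by_contra hne'
    have h3 : G.dist u y = r + 2 := by omega
    have h4 := hG.dist_add_dist_le (u := y) (v := p) (w := u) (x := z) hpu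
      (by rw [G.dist_comm (u := y), G.dist_comm (u := y)]; omega) (by omega)
    have h5 := hG.connected.dist_triangle (u := y) (v := c) (w := z)
    have h6 := hc z
    rw [G.dist_comm (u := y) (v := p)] at h4
    rw [G.dist_comm (u := y) (v := c)] at h5
    omega
  obtain ⟨g, htg, hug, hg⟩ := hG.exists_common_neighbor hut hty huy'
  have hgc : G.Adj g c := by
    rcases hG.eq_or_adj_of_adj_of_adj htg htc hty hg hcy with rfl | h
    · exact absurd hug huc
    · exact h
  have hts : G.Adj t s := by
    rcases hG.eq_or_adj_of_adj_of_adj hpt hps hpc (dist_eq_one_iff_adj.2 htc)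
      (dist_eq_one_iff_adj.2 hsc) with rfl | h
    · omega
    · exact h
  have hgs : G.Adj g s := by
    rcases hG.eq_or_adj_of_adj_of_adj htg hts hty hg hsy with rfl | h
    · exact absurd hug.symm hus
    · exact h
  -- The four-cycle `u p s g` lacks the diagonal `u s`. This makes `g` a middle vertex, to which
  -- `hA` and `hB` apply.
  have hpg : G.Adj p g := by
    refine hG.adj_of_four_cycle hpu.symm hps hgs.symm hug.symm (fun h => hus h.symm) ?_ ?_
    · rintro rfl
      rw [dist_eq_one_iff_adj.2 hgc] at hpc
      omega
    · rintro rfl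
      exact huc hsc
  have hgz : r < G.dist g z ∨ G.dist g z = r := by
    have := hG.connected.dist_le_dist_add_one hpg z
    omega
  rcases hgz with h | h
  · have := hA hgc hug.symm h
    omega
  · have := hB g y hpg hgc h huy
    omega

end Descent


/-- Unless `p` itself is good enough, its eccentricity is `r + 1` and `c` is a competitor of `q`.
All vertices are nearer to `c` than `r + 1`, so the same is true of the maximal `q`. -/
theorem eccLE_of_isDescent_of_adj [Finite V] {p q c : V} {r : ℕ} (hpq : G.IsDescent p q)
    (hpc : G.Adj p c) (hc : G.EccLE c r) : G.EccLE p r ∨ G.EccLE q r := by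
  have hp : G.EccLE p (r + 1) := fun y => by
    have h1 := hG.connected.dist_le_dist_add_one hpc y
    have h2 := hc y
    omega
  by_cases hpr : G.EccLE p r
  · exact Or.inl hpr
  obtain ⟨z, hz, hadj, hqz, hmax⟩ := hpq
  have hz' : G.dist p z = r + 1 := by
    simp only [EccLE, not_forall, not_le] at hpr
    obtain ⟨y, hy⟩ := hpr
    have h1 := hz y
    have h2 := hp z
    omega
  simp only [hz', Nat.add_right_cancel_iff] at hqz hmax
  have h1 := hG.connected.dist_le_dist_add_one hpc z
  have h2 := hc z
  have h3 := hmax c hpc (by omega)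
  have h4 : {y | G.dist c y < r + 1} = Set.univ :=
    Set.eq_univ_of_forall fun y => Nat.lt_succ_of_le (hc y)
  have h5 : {y | G.dist q y < r + 1} = Set.univ :=
    Set.eq_of_subset_of_ncard_le (Set.subset_univ _) (by rw [← h4]; exact h3)
  refine Or.inr fun y => ?_
  have h6 : y ∈ {y | G.dist q y < r + 1} := h5 ▸ Set.mem_univ y
  exact Nat.le_of_lt_succ h6

theorem eccLE_of_isDescent [Finite V] {p q c : V} {r : ℕ} (hpq : G.IsDescent p q)
    (hp : G.EccLE p (r + 1)) (hc : G.EccLE c r) :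
    G.EccLE p r ∨ G.EccLE q r ∨ ∃ c, G.Adj q c ∧ G.EccLE c r := by
  by_cases hpr : G.EccLE p r
  · exact Or.inl hpr
  have hdesc := hpq
  obtain ⟨z, hz, hadj, hqz, hmax⟩ := hpq
  have hz' : G.dist p z = r + 1 := by
    simp only [EccLE, not_forall, not_le] at hpr
    obtain ⟨y, hy⟩ := hpr
    have h1 := hz y
    have h2 := hp z
    omega
  rw [hz'] at hqz
  simp only [hz', Nat.add_right_cancel_iff] at hqz hmax
  by_cases hno : ∀ c, G.Adj p c → ¬ G.EccLE c r
  · obtain ⟨c, hc, hc2⟩ := hG.exists_eccLE_dist_le_two hp hc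
    have hpc : p ≠ c := by rintro rfl; exact hpr hc
    have hpc2 := hG.connected.one_lt_dist_of_ne_of_not_adj hpc (fun h => hno c h hc)
    exact Or.inr (Or.inr ⟨c, hG.adj_of_maximal hp hc (by omega) hno hz' hadj hqz hmax, hc⟩)
  · push Not at hno
    obtain ⟨c, hpc, hc⟩ := hno
    exact (hG.eccLE_of_isDescent_of_adj hdesc hpc hc).imp_right Or.inl

/-- Each unit of eccentricity costs at most two steps: one to become adjacent to a better vertex,
one to be as good. Since `R ≥ 1`, a vertex that is not good enough has some vertex at distance at
least two, so its step is a genuine descent. -/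
theorem exists_eccLE_of_descents [Finite V] {f : ℕ → V} {c : V} {R : ℕ} (hR : 1 ≤ R)
    (hc : G.EccLE c R) (hf : ∀ i < 7, (∃ y, 2 ≤ G.dist (f i) y) → G.IsDescent (f i) (f (i + 1)))
    (h0 : G.EccLE (f 0) (R + 3)) : ∃ i ≤ 6, G.EccLE (f i) R := by
  have hstep : ∀ i r, i ≤ 4 → R ≤ r → G.EccLE (f i) (r + 1) → ∃ j ≤ i + 2, G.EccLE (f j) r := by
    intro i r hi4 hr hi
    have hcr : G.EccLE c r := fun y => (hc y).trans hr
    by_contra! hno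
    have hd : ∀ j ≤ i + 2, G.IsDescent (f j) (f (j + 1)) := fun j hj => by
      have := hno j hj
      simp only [EccLE, not_forall, not_le] at this
      obtain ⟨y, hy⟩ := this
      exact hf j (by omega) ⟨y, by omega⟩
    rcases hG.eccLE_of_isDescent (hd i (by omega)) hi hcr with h | h | ⟨c, hadj, hc⟩
    · exact hno i (by omega) h
    · exact hno (i + 1) (by omega) h
    · rcases hG.eccLE_of_isDescent_of_adj (hd (i + 1) (by omega)) hadj hc with h | h
      · exact hno (i + 1) (by omega) h
      · exact hno (i + 2) (by omega) h
  obtain ⟨i, hi, h1⟩ := hstep 0 (R + 2) (by omega) (by omega) h0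
  obtain ⟨j, hj, h2⟩ := hstep i (R + 1) (by omega) (by omega) h1
  obtain ⟨k, hk, h3⟩ := hstep j R (by omega) (by omega) h2
  exact ⟨k, by omega, h3⟩

/-! ### Slices, midpoints and the starting vertex. -/

/-- Slices of intervals have diameter at most two. -/
theorem not_geodesic_in_slice {u v a b x y : V} {i j : ℕ} (hab : G.Adj a b) (hbx : G.Adj b x)
    (hxy : G.Adj x y) (hay : G.dist a y = 3) (huv : G.dist u v = i + j) (hau : G.dist a u = i)
    (hbu : G.dist x u = i) (hyu : G.dist y u = i) (hav : G.dist a v = j) (hxv : G.dist x v = j)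
    (hyv : G.dist y v = j) : False := by
  -- For each end of the interval, `x` and `y` have a common neighbour nearer to that end. By α₁ it
  -- is not farther from `a` than `x` is. The two vertices so found are equal or adjacent, which
  -- shortcuts the geodesic between the ends.
  have key : ∀ {w : V} {k : ℕ}, G.dist a w = k → G.dist x w = k → G.dist y w = k →
      ∃ p, G.dist p w + 1 = k ∧ G.Adj y p ∧ G.dist p a = 2 := by
    intro w k ha hx hy
    obtain ⟨p, hxp, hyp, hp⟩ := hG.triangle x y w k hxy hx hy
    refine ⟨p, hp, hyp, ?_⟩
    have h1 := hG.connected.dist_le_dist_add_one hyp a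
    have h2 := hG.connected.dist_le_dist_add_one hxp.symm a
    have h3 := hG.connected.dist_le_dist_add_one hbx.symm a
    have h4 := hG.connected.dist_le_dist_add_one hxy.symm a
    have h5 := dist_eq_one_iff_adj.2 hab.symm
    rw [dist_comm] at hay
    by_contra hne
    have := hG.dist_add_dist_le (u := a) (v := x) (w := p) (x := w) hxp
      (by rw [G.dist_comm (u := a), G.dist_comm (u := a)]; omega) (by omega)
    rw [G.dist_comm (v := x)] at this
    omega
  obtain ⟨p, hpu, hyp, hpa⟩ := key hau hbu hyu
  obtain ⟨q, hqv, hyq, hqa⟩ := key hav hxv hyv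
  have h1 := hG.connected.dist_triangle (u := u) (v := p) (w := v)
  have h2 := hG.connected.dist_triangle (u := p) (v := q) (w := v)
  rw [G.dist_comm (u := u) (v := p)] at h1
  rcases hG.eq_or_adj_of_adj_of_adj hyp hyq (by rw [dist_comm]; exact hay) hpa hqa with rfl | h
  · rw [dist_self] at h2
    omega
  · rw [dist_eq_one_iff_adj.2 h] at h2
    omega

/-- If both bounds fail, three steps from `m` towards `y` keep the distances to `z` and `w`, so they
form a geodesic of length three in a slice. -/
theorem dist_add_dist_le_of_mem_interval {z w m : V} (hm : G.dist z m + G.dist m w = G.dist z w)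
    (y : V) : G.dist m y + G.dist z m ≤ G.dist z y + 3 ∨ G.dist m y + G.dist m w ≤ G.dist w y + 3 := by
  by_contra! hcon
  obtain ⟨hcz, hcw⟩ := hcon
  have htr := hG.connected.dist_triangle (u := z) (v := y) (w := w)
  rw [G.dist_comm (u := y) (v := w)] at htr
  have hcw' := G.dist_comm (u := m) (v := w)
  have hcz' := G.dist_comm (u := m) (v := z)
  have hstep : ∀ b k, G.dist b y = k + 1 → G.dist m y ≤ k + 3 → G.dist b z = G.dist z m →
      G.dist b w = G.dist m w →
      ∃ b', G.Adj b b' ∧ G.dist b' y = k ∧ G.dist b' z = G.dist z m ∧ G.dist b' w = G.dist m w := by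
    intro b k hb hk hbz hbw
    obtain ⟨b', hbb', hb'⟩ := hG.connected.exists_adj_dist_eq hb
    -- A step away from `v` could be glued to the rest of the geodesic to `y`, making `d(v,y)` too
    -- large. Not increasing either end distance forces both to stay equal.
    have hle : ∀ v, k + G.dist b v > G.dist v y → G.dist b' v ≤ G.dist b v := by
      intro v hv
      by_contra! h
      have h1 := hG.connected.dist_le_dist_add_one hbb'.symm v
      have := hG.dist_add_dist_le (u := v) (v := b) (w := b') (x := y) hbb'
        (by rw [G.dist_comm (u := v), G.dist_comm (u := v)]; omega) (by omega)
      rw [G.dist_comm (v := b)] at this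
      omega
    have h1 := hle z (by omega)
    have h2 := hle w (by omega)
    have h3 := hG.connected.dist_triangle (u := z) (v := b') (w := w)
    rw [G.dist_comm (u := z) (v := b')] at h3
    exact ⟨b', hbb', hb', by omega, by omega⟩
  obtain ⟨h, hh⟩ : ∃ h, G.dist m y = h + 3 := ⟨G.dist m y - 3, by omega⟩
  obtain ⟨b, hmb, hb, hbz, hbw⟩ := hstep m (h + 2) hh (by omega) hcz' rfl
  obtain ⟨x, hbx, hx, hxz, hxw⟩ := hstep b (h + 1) hb (by omega) hbz hbw
  obtain ⟨a, hxa, ha, haz, haw⟩ := hstep x h hx (by omega) hxz hxw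
  have h1 := hG.connected.dist_triangle (u := m) (v := a) (w := y)
  have h2 := hG.connected.dist_triangle (u := m) (v := x) (w := a)
  have h3 := hG.connected.dist_triangle (u := m) (v := b) (w := x)
  rw [dist_eq_one_iff_adj.2 hxa] at h2
  rw [dist_eq_one_iff_adj.2 hmb, dist_eq_one_iff_adj.2 hbx] at h3
  exact hG.not_geodesic_in_slice hmb hbx hxa (by omega) hm.symm hcz' hxz haz rfl hxw haw

/-- The two alternatives for `y` give `d(m,y) ≤ D - d(z,m) + 3` or `d(m,y) ≤ d(z,m) + 3`. Both are
at most `R + 3`, because `D ≤ 2R` through `c` and `d(z,m)` is `D/2` rounded up. -/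
theorem eccLE_of_midpoint {p z m c : V} {D R : ℕ} (hz : ∀ y, G.dist p y ≤ G.dist p z)
    (hD : ∀ y, G.dist z y ≤ D) (hD' : ∃ y, G.dist z y = D)
    (hm : G.dist z m + G.dist m p = G.dist z p) (h1 : D ≤ 2 * G.dist z m)
    (h2 : 2 * G.dist z m ≤ D + 1) (hc : G.EccLE c R) : G.EccLE m (R + 3) := by
  obtain ⟨w, hw⟩ := hD'
  have h3 := hG.connected.dist_triangle (u := z) (v := c) (w := w)
  have h4 := hc w
  have h5 := hc z
  rw [G.dist_comm (u := z) (v := c)] at h3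
  intro y
  have h6 := hz y
  have h7 := hD y
  rw [G.dist_comm (u := p) (v := z)] at h6
  rcases hG.dist_add_dist_le_of_mem_interval hm y with h | h <;> omega

theorem mem_center_of_eccLE [Finite V] {c : V} {R : ℕ} (hc : G.EccLE c R)
    (hR : ∀ v r, G.EccLE v r → R ≤ r) : c ∈ G.center := by
  have hcoe : ∀ u v, (G.dist u v : ℕ∞) = G.edist u v :=
    fun u v => (hG.connected u v).coe_dist_eq_edist
  have h1 : G.eccent c ≤ R := by
    rw [eccent_le_iff]
    intro v
    rw [← hcoe]
    exact_mod_cast hc v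
  have h2 : (R : ℕ∞) ≤ G.radius := by
    refine le_iInf fun u => ?_
    have : Nonempty V := ⟨c⟩
    obtain ⟨v, hv⟩ := G.exists_edist_eq_eccent_of_finite u
    rw [← hv, ← hcoe]
    have := hR u (G.dist u v) (fun y => by
      have h3 : G.edist u y ≤ G.edist u v := hv ▸ edist_le_eccent
      rw [← hcoe, ← hcoe] at h3
      exact_mod_cast h3)
    exact_mod_cast this
  exact le_antisymm (h1.trans h2) radius_le_eccent

end IsAlphaOneDeltaMetric
end SimpleGraph

/-! ## Levels and gates with respect to a set of vertices -/

namespace SimpleGraph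

variable {V : Type*}

/-- `lev` is the distance from the set `K`, described locally. -/
structure IsLevel (G : SimpleGraph V) (K : Set V) (lev : V → ℕ) : Prop where
  eq_zero_iff : ∀ x, lev x = 0 ↔ x ∈ K
  le_add_one : ∀ x y, G.Adj x y → lev y ≤ lev x + 1
  exists_adj : ∀ x l, lev x = l + 1 → ∃ y, G.Adj x y ∧ lev y = l

/-- The vertices of `K` adjacent to `g` are the vertices of `K` nearest to `y`. -/
def IsGate (G : SimpleGraph V) (K : Set V) (lev : V → ℕ) (g y : V) : Prop :=
  ∀ u ∈ K, G.Adj u g ↔ G.dist u y = lev y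

/-- The number of vertices of `K` nearest to `y`. -/
noncomputable def projCard (G : SimpleGraph V) (K : Set V) (lev : V → ℕ) (y : V) : ℕ :=
  {u | u ∈ K ∧ G.dist u y = lev y}.ncard

variable {G : SimpleGraph V}

theorem Connected.isLevel_singleton (hc : G.Connected) (p : V) : G.IsLevel {p} (G.dist p) where
  eq_zero_iff x := by rw [hc.dist_eq_zero_iff]; exact eq_comm
  le_add_one x y h := by
    have := hc.dist_le_dist_add_one h.symm p
    rwa [dist_comm, G.dist_comm (u := x)] at this
  exists_adj x l h := by
    obtain ⟨y, h1, h2⟩ := hc.exists_adj_dist_eq (u := x) (v := p) (k := l) (by rwa [dist_comm])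
    exact ⟨y, h1, by rwa [dist_comm]⟩

theorem Connected.exists_isLevel (hc : G.Connected) {K : Set V} (hK : K.Nonempty) :
    ∃ lev, G.IsLevel K lev := by
  classical
  have hex : ∀ x, ∃ l, ∃ u ∈ K, G.dist x u = l := fun x => ⟨_, hK.some, hK.some_mem, rfl⟩
  have hle : ∀ x u, u ∈ K → Nat.find (hex x) ≤ G.dist x u :=
    fun x u hu => Nat.find_min' (hex x) ⟨u, hu, rfl⟩
  refine ⟨fun x => Nat.find (hex x), fun x => ⟨fun h => ?_, fun h => ?_⟩, fun x y hxy => ?_,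
    fun x l hl => ?_⟩
  · obtain ⟨u, hu, hxu⟩ := Nat.find_spec (hex x)
    rw [h, hc.dist_eq_zero_iff] at hxu
    exact hxu ▸ hu
  · have := hle x x h
    rw [dist_self] at this
    exact Nat.le_zero.1 this
  · obtain ⟨u, hu, hxu⟩ := Nat.find_spec (hex x)
    have h1 := hle y u hu
    have h2 := hc.dist_le_dist_add_one hxy.symm u
    omega
  · obtain ⟨u, hu, hxu⟩ := Nat.find_spec (hex x)
    obtain ⟨y, hxy, hy⟩ := hc.exists_adj_dist_eq (hxu.trans hl)
    refine ⟨y, hxy, ?_⟩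
    have h1 := hle y u hu
    obtain ⟨u', hu', hyu'⟩ := Nat.find_spec (hex y)
    have h2 := hle x u' hu'
    have h3 := hc.dist_le_dist_add_one hxy u'
    omega

/-! ### Projections to a set and their gates. -/

namespace IsLevel

variable {K : Set V} {lev : V → ℕ} (hl : G.IsLevel K lev)
include hl

theorem le_dist (hc : G.Connected) {u : V} (hu : u ∈ K) (x : V) : lev x ≤ G.dist u x := by
  induction h : G.dist u x generalizing x with
  | zero =>
    rw [hc.dist_eq_zero_iff] at h
    exact ((hl.eq_zero_iff x).2 (h ▸ hu)).le
  | succ k ih =>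
    obtain ⟨y, hxy, hy⟩ := hc.exists_adj_dist_eq (u := x) (v := u) (k := k) (by rwa [dist_comm])
    have h1 := ih y (by rwa [dist_comm])
    have h2 := hl.le_add_one y x hxy.symm
    omega

theorem exists_dist_eq (hc : G.Connected) (x : V) : ∃ u ∈ K, G.dist u x = lev x := by
  induction h : lev x generalizing x with
  | zero => exact ⟨x, (hl.eq_zero_iff x).1 h, by simp⟩
  | succ k ih =>
    obtain ⟨y, hxy, hy⟩ := hl.exists_adj x k h
    obtain ⟨u, hu, huy⟩ := ih y hy
    have h1 := hl.le_dist hc hu x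
    have h2 := hc.dist_le_dist_add_one hxy u
    rw [dist_comm, G.dist_comm (u := y)] at h2
    exact ⟨u, hu, by omega⟩

theorem projCard_pos [Finite V] (hc : G.Connected) (x : V) : 0 < G.projCard K lev x := by
  obtain ⟨u, hu, h⟩ := hl.exists_dist_eq hc x
  exact (Set.ncard_pos (Set.toFinite _)).2 ⟨u, hu, h⟩

theorem proj_subset (hc : G.Connected) {x y : V} (hxy : G.Adj x y) (h : lev y + 1 = lev x) :
    {u | u ∈ K ∧ G.dist u y = lev y} ⊆ {u | u ∈ K ∧ G.dist u x = lev x} := by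
  rintro u ⟨hu, huy⟩
  have h1 := hl.le_dist hc hu x
  have h2 := hc.dist_le_dist_add_one hxy u
  rw [dist_comm, G.dist_comm (u := y)] at h2
  exact ⟨hu, by omega⟩

omit hl in
theorem isGate_self {x : V} (h : lev x = 1) : G.IsGate K lev x x := fun u _ => by
  rw [h, dist_eq_one_iff_adj]

/-- The projection can only grow from `y` to `x`, so the inequality of cardinalities makes the two
projections equal. -/
theorem isGate_of_projCard_le [Finite V] (hc : G.Connected) {x y g : V} (hxy : G.Adj x y)
    (h : lev y + 1 = lev x) (hg : G.IsGate K lev g y)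
    (hcard : G.projCard K lev x ≤ G.projCard K lev y) : G.IsGate K lev g x := by
  have heq := Set.eq_of_subset_of_ncard_le (hl.proj_subset hc hxy h) hcard (Set.toFinite _)
  intro u hu
  have : u ∈ {u | u ∈ K ∧ G.dist u y = lev y} ↔ u ∈ {u | u ∈ K ∧ G.dist u x = lev x} := by rw [heq]
  simp only [Set.mem_ofPred_eq, hu, true_and] at this
  rw [hg u hu, this]

/-- The projection of `x` is a clique equidistant from `x`, hence has a common neighbour one step
nearer. The first vertex `y` from `x` towards it keeps the whole projection, so some inner neighbour
always has a gate to hand on. -/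
theorem exists_projCard_le [Finite V] (hG : G.IsAlphaOneDeltaMetric)
    (hK : ∀ u ∈ K, ∀ v ∈ K, u ≠ v → G.Adj u v) {x : V} {l : ℕ} (h : lev x = l + 2) :
    ∃ y, G.Adj x y ∧ lev y = l + 1 ∧ G.projCard K lev x ≤ G.projCard K lev y := by
  have hc := hG.connected
  obtain ⟨u₀, hu₀, hux₀⟩ := hl.exists_dist_eq hc x
  obtain ⟨g, hg, hgK⟩ := hG.exists_common_neighbor_of_clique x (l + 1)
    (Set.toFinite {u | u ∈ K ∧ G.dist u x = lev x}).toFinset ⟨u₀, by simp [hu₀, hux₀]⟩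
    (fun u hu v hv => hK u (by simp_all) v (by simp_all)) (fun u hu => by simp_all)
  simp only [Set.Finite.mem_toFinset, Set.mem_ofPred_eq, and_imp] at hgK
  obtain ⟨y, hxy, hy⟩ := hc.exists_adj_dist_eq (u := x) (v := g) (k := l) (by rwa [dist_comm])
  have key : ∀ u, u ∈ K → G.dist u x = lev x → G.dist u y = l + 1 ∧ lev y = l + 1 := by
    intro u hu hux
    have h1 := hc.dist_triangle (u := u) (v := g) (w := y)
    rw [dist_eq_one_iff_adj.2 (hgK u hu hux), G.dist_comm (u := g), hy] at h1
    have h2 := hc.dist_le_dist_add_one hxy u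
    rw [dist_comm, G.dist_comm (u := y)] at h2
    have h3 := hl.le_dist hc hu y
    have h4 := hl.le_add_one y x hxy.symm
    omega
  refine ⟨y, hxy, (key u₀ hu₀ hux₀).2, Set.ncard_le_ncard ?_ (Set.toFinite _)⟩
  rintro u ⟨hu, hux⟩
  have := key u hu hux
  exact ⟨hu, by omega⟩

/-- In a clique the distance to `y` is `lev y` or `lev y + 1`. So levels below `r` count fully,
levels above `r` not at all, and level `r` is decided by the gates. Level 0 has no gates, hence `r ≠
0`. -/
theorem nearCard_le_nearCard [Finite V] (hc : G.Connected)
    (hK : ∀ u ∈ K, ∀ v ∈ K, u ≠ v → G.Adj u v) {gate : V → V}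
    (hgate : ∀ y, lev y ≠ 0 → G.IsGate K lev (gate y) y) {r : ℕ} (hr : r ≠ 0) {u v : V}
    (hu : u ∈ K) (hv : v ∈ K)
    (hle : {y | lev y = r ∧ G.Adj u (gate y)}.ncard ≤ {y | lev y = r ∧ G.Adj v (gate y)}.ncard) :
    G.nearCard u (r + 1) ≤ G.nearCard v (r + 1) := by
  have key : ∀ u ∈ K, G.nearCard u (r + 1) =
      {y | lev y < r}.ncard + {y | lev y = r ∧ G.Adj u (gate y)}.ncard := by
    intro u hu
    rw [nearCard, ← Set.ncard_union_eq]
    · congr 1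
      ext y
      simp only [Set.mem_ofPred_eq, Set.mem_union]
      have h1 := hl.le_dist hc hu y
      rcases lt_trichotomy (lev y) r with h | h | h
      · obtain ⟨w, hw, hwy⟩ := hl.exists_dist_eq hc y
        have h2 : G.dist u y ≤ G.dist w y + 1 := by
          by_cases huw : u = w
          · subst huw; omega
          · exact hc.dist_le_dist_add_one (hK u hu w hw huw) y
        exact ⟨fun _ => Or.inl h, fun _ => by omega⟩
      · rw [hgate y (by omega) u hu]
        omega
      · omega
    · rw [Set.disjoint_left]
      rintro y h1 ⟨h2, -⟩
      simp only [Set.mem_ofPred_eq] at h1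
      omega
  rw [key u hu, key v hv]
  omega

end IsLevel
end SimpleGraph

/-! ## Reasoning about programs of the random access machine -/

namespace RAM

@[simp] theorem State.setReg_reg (s : State) (r v : ℕ) :
    (s.setReg r v).reg = Function.update s.reg r v := rfl

@[simp] theorem State.setReg_mem (s : State) (r v : ℕ) : (s.setReg r v).mem = s.mem := rfl

@[simp] theorem State.setMem_reg (s : State) (a i v : ℕ) : (s.setMem a i v).reg = s.reg := rfl

@[simp] theorem State.setMem_mem (s : State) (a i v : ℕ) :
    (s.setMem a i v).mem = Function.update s.mem a (Function.update (s.mem a) i v) := rfl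

/-- The program `P` started in `s` halts within `T` steps in a state satisfying `Q`. -/
def Runs (W T : ℕ) (P : Program) (s : State) (Q : State → Prop) : Prop :=
  ∃ t s', Exec W P s t s' ∧ t ≤ T ∧ Q s'

theorem Runs.mono {W T T' : ℕ} {P : Program} {s : State} {Q Q' : State → Prop}
    (h : Runs W T P s Q) (hT : T ≤ T') (hQ : ∀ s', Q s' → Q' s') : Runs W T' P s Q' := by
  obtain ⟨t, s', h1, h2, h3⟩ := h
  exact ⟨t, s', h1, h2.trans hT, hQ s' h3⟩

theorem Runs.seq {W T₁ T₂ : ℕ} {P₁ P₂ : Program} {s : State} {Q R : State → Prop}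
    (h : Runs W T₁ P₁ s R) (h' : ∀ s', R s' → Runs W T₂ P₂ s' Q) :
    Runs W (T₁ + T₂) (P₁.seq P₂) s Q := by
  obtain ⟨t, s', h1, h2, h3⟩ := h
  obtain ⟨t', s'', h4, h5, h6⟩ := h' s' h3
  exact ⟨t + t', s'', h1.seq h4, by omega, h6⟩

/-- The effect of a program without loops. -/
def Program.exec : Program → State → State
  | skip, s => s
  | assign r e, s => s.setReg r (e.eval s)
  | store a e f, s => s.setMem a (e.eval s) (f.eval s)
  | seq p q, s => q.exec (p.exec s)
  | ifNonzero e p q, s => if e.eval s ≠ 0 then p.exec s else q.exec s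
  -- A dummy value: `Program.Fits` is false for loops, so it is never used.
  | whileNonzero _ _, s => s

/-- No number exceeding `W` occurs in the run of a program without loops. -/
def Program.Fits (W : ℕ) : Program → State → Prop
  | skip, _ => True
  | assign _ e, s => e.Fits W s
  | store _ e f, s => e.Fits W s ∧ f.Fits W s
  | seq p q, s => p.Fits W s ∧ q.Fits W (p.exec s)
  | ifNonzero e p q, s =>
    e.Fits W s ∧ (e.eval s ≠ 0 → p.Fits W s) ∧ (e.eval s = 0 → q.Fits W s)
  | whileNonzero _ _, _ => False

/-- A bound for the running time of a program without loops. -/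
def Program.ticks : Program → ℕ
  | skip => 1
  | assign _ e => e.cost + 1
  | store _ e f => e.cost + f.cost + 1
  | seq p q => p.ticks + q.ticks
  | ifNonzero e p q => e.cost + 1 + (p.ticks + q.ticks)
  | whileNonzero _ _ => 0

theorem Program.runs_exec {W : ℕ} (P : Program) (s : State) (h : P.Fits W s) :
    Runs W P.ticks P s fun s' => s' = P.exec s := by
  induction P generalizing s with
  | skip => exact ⟨_, _, .skip s, le_rfl, rfl⟩
  | assign r e => exact ⟨_, _, .assign s r e h, le_rfl, rfl⟩
  | store a e f => exact ⟨_, _, .store s a e f h.1 h.2, le_rfl, rfl⟩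
  | seq p q ihp ihq =>
    refine (ihp s h.1).seq ?_
    rintro _ rfl
    exact ihq _ h.2
  | ifNonzero e p q ihp ihq =>
    obtain ⟨he, hp, hq⟩ := h
    by_cases h0 : e.eval s = 0
    · obtain ⟨t, s', h1, h2, h3⟩ := ihq s (hq h0)
      exact ⟨_, _, .ifFalse he h0 h1, by simp only [ticks]; omega, by simp [exec, h0, h3]⟩
    · obtain ⟨t, s', h1, h2, h3⟩ := ihp s (hp h0)
      exact ⟨_, _, .ifTrue he h0 h1, by simp only [ticks]; omega, by simp [exec, h0, h3]⟩
  | whileNonzero => exact h.elim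

theorem Program.runs_of_exec {W T : ℕ} {P : Program} {s : State} {Q : State → Prop}
    (h : P.Fits W s) (hT : P.ticks ≤ T) (hQ : Q (P.exec s)) : Runs W T P s Q :=
  (P.runs_exec s h).mono hT (by rintro _ rfl; exact hQ)

/-- The rule for loops with a time credit `T`. -/
theorem runs_while {W : ℕ} {e : Expr} {P : Program} {Q : State → Prop} (I : State → ℕ → Prop)
    (hI : ∀ s T, I s T → e.Fits W s ∧ (e.eval s = 0 → e.cost + 1 ≤ T ∧ Q s) ∧
      (e.eval s ≠ 0 → ∃ T₁ T₂, e.cost + 1 + T₁ + T₂ ≤ T ∧ Runs W T₁ P s fun s' => I s' T₂))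
    {s : State} {T : ℕ} (h : I s T) : Runs W T (.whileNonzero e P) s Q := by
  -- Every round pays for its test, so the remaining credit strictly decreases.
  induction T using Nat.strong_induction_on generalizing s with
  | _ T ih =>
    obtain ⟨he, h0, h1⟩ := hI s T h
    by_cases hz : e.eval s = 0
    · exact ⟨_, _, .whileFalse he hz, (h0 hz).1, (h0 hz).2⟩
    · obtain ⟨T₁, T₂, hT, t, s', hx, ht, hI'⟩ := h1 hz
      obtain ⟨t', s'', hx', ht', hQ⟩ := ih T₂ (by omega) hI'
      exact ⟨_, _, .whileTrue he hz hx hx', by omega, hQ⟩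

/-- The rule for loops with a counter `i` that runs up to `N`. -/
theorem runs_while_count {W B N : ℕ} {e : Expr} {P : Program} (I : ℕ → State → Prop)
    (hI : ∀ i s, I i s → i < N → e.Fits W s ∧ e.eval s ≠ 0 ∧ Runs W B P s (I (i + 1)))
    (hN : ∀ s, I N s → e.Fits W s ∧ e.eval s = 0) {i : ℕ} (hi : i ≤ N) {s : State} (h : I i s) :
    Runs W ((N - i) * (e.cost + 1 + B) + (e.cost + 1)) (.whileNonzero e P) s (I N) := by
  refine runs_while
    (fun s T => ∃ i ≤ N, I i s ∧ T = (N - i) * (e.cost + 1 + B) + (e.cost + 1)) ?_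
    ⟨i, hi, h, rfl⟩
  rintro s T ⟨i, hi, h, rfl⟩
  rcases hi.lt_or_eq with hlt | rfl
  · obtain ⟨h1, h2, h3⟩ := hI i s h hlt
    refine ⟨h1, fun h0 => absurd h0 h2, fun _ => ⟨B, _, ?_, h3.mono le_rfl
      fun s' hs' => ⟨i + 1, hlt, hs', rfl⟩⟩⟩
    obtain ⟨k, hk⟩ : ∃ k, N - i = k + 1 := ⟨N - i - 1, by omega⟩
    have hk' : N - (i + 1) = k := by omega
    rw [hk, hk', add_mul]
    omega
  · obtain ⟨h1, h2⟩ := hN s h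
    exact ⟨h1, fun _ => ⟨by simp, h⟩, fun h0 => absurd h2 h0⟩

end RAM

namespace RAM

/-! ## Loops over the vertices and over the adjacency lists -/

/-- Runs `body` with the register `1` ranging over the vertices. -/
def forVertices (body : Program) : Program :=
  .seq (.assign 1 (.const 0)) (.whileNonzero (.sub (.reg 0) (.reg 1))
    (.seq body (.assign 1 (.add (.reg 1) (.const 1)))))

/-- Runs `body` with the register `6` ranging over the list of the vertex in the register `3`. -/
def forNeighbors (body : Program) : Program :=
  .whileNonzero (.sub (.reg 5) (.reg 4))
    (.seq (.assign 6 (.load 1 (.reg 4))) (.seq body (.assign 4 (.add (.reg 4) (.const 1)))))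

/-- Runs `body` with the register `3` ranging over the array `2` and the register `6` ranging over
the list of the vertex in the register `3`. -/
def scan (body : Program) : Program :=
  .seq (.assign 2 (.const 0)) (.whileNonzero (.sub (.reg 0) (.reg 2))
    (.seq (.assign 3 (.load 2 (.reg 2))) (.seq (.assign 4 (.load 0 (.reg 3)))
      (.seq (.assign 5 (.load 0 (.add (.reg 3) (.const 1))))
        (.seq (forNeighbors body) (.assign 2 (.add (.reg 2) (.const 1))))))))

/-- The sizes of the input are bounded by `M`, and words have room for `10 * M`. -/
structure Bounds {n : ℕ} (adj : Fin n → List (Fin n)) (M W : ℕ) : Prop where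
  pos : 1 ≤ M
  le : n ≤ M
  sum_le : ∑ v, (adj v).length ≤ 2 * M
  word : 10 * M ≤ W

/-- The machine holds the adjacency lists `adj`. -/
structure Holds {n : ℕ} (adj : Fin n → List (Fin n)) (M : ℕ) (s : State) : Prop where
  reg : s.reg 0 = n
  offset_succ : ∀ v : Fin n, s.mem 0 (v + 1) = s.mem 0 v + (adj v).length
  offset_le : ∀ i ≤ n, s.mem 0 i ≤ 2 * M
  entry : ∀ (v : Fin n) (j : ℕ) (h : j < (adj v).length), s.mem 1 (s.mem 0 v + j) = (adj v)[j]

/-- The input and the registers from `10` on are the same. -/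
structure Frame (s s' : State) : Prop where
  reg : ∀ r, r = 0 ∨ 10 ≤ r → s'.reg r = s.reg r
  mem_zero : s'.mem 0 = s.mem 0
  mem_one : s'.mem 1 = s.mem 1

theorem Frame.refl (s : State) : Frame s s := ⟨fun _ _ => rfl, rfl, rfl⟩

theorem Frame.trans {s s' s'' : State} (h : Frame s s') (h' : Frame s' s'') : Frame s s'' :=
  ⟨fun r hr => (h'.reg r hr).trans (h.reg r hr), h'.mem_zero.trans h.mem_zero,
    h'.mem_one.trans h.mem_one⟩

theorem Frame.setReg {s s' : State} (h : Frame s s') {r : ℕ} (hr : 1 ≤ r ∧ r < 10) (v : ℕ) :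
    Frame s (s'.setReg r v) :=
  ⟨fun r' hr' => by
    rw [State.setReg_reg, Function.update_of_ne (by omega), h.reg r' hr'], h.mem_zero, h.mem_one⟩

variable {n : ℕ} {adj : Fin n → List (Fin n)} {M W : ℕ}

theorem Holds.of_frame {s s' : State} (h : Holds adj M s) (hf : Frame s s') : Holds adj M s' where
  reg := (hf.reg 0 (Or.inl rfl)).trans h.reg
  offset_succ := by rw [hf.mem_zero]; exact h.offset_succ
  offset_le := by rw [hf.mem_zero]; exact h.offset_le
  entry := by rw [hf.mem_zero, hf.mem_one]; exact h.entry

theorem runs_forVertices (hB : Bounds adj M W) {body : Program} {s : State} (hs : Holds adj M s)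
    (I : ℕ → (ℕ → ℕ → ℕ) → Prop) (h0 : I 0 s.mem)
    (hstep : ∀ i < n, ∀ s', I i s'.mem → s'.reg 1 = i → Frame s s' →
      body.Fits W s' ∧ (body.exec s').reg = s'.reg ∧ (body.exec s').mem 0 = s'.mem 0 ∧
        (body.exec s').mem 1 = s'.mem 1 ∧ I (i + 1) (body.exec s').mem) :
    Runs W (M * (body.ticks + 14)) (forVertices body) s fun s' => Frame s s' ∧ I n s'.mem := by
  have hn := hB.le
  have hw := hB.word
  have hpos := hB.pos
  have hloop := runs_while_count (W := W) (B := body.ticks + 4) (N := n)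
    (e := .sub (.reg 0) (.reg 1)) (P := .seq body (.assign 1 (.add (.reg 1) (.const 1))))
    (fun i s' => Frame s s' ∧ s'.reg 1 = i ∧ I i s'.mem) ?_ ?_ (Nat.zero_le n)
    (s := s.setReg 1 0) ⟨(Frame.refl s).setReg (by omega) 0, by simp, h0⟩
  · have h1 := Runs.seq (Program.runs_exec (W := W) (.assign 1 (.const 0)) s
      (by simp [Program.Fits, Expr.Fits]))
      (T₂ := (n - 0) * (Expr.cost (.sub (.reg 0) (.reg 1)) + 1 + (body.ticks + 4)) +
        (Expr.cost (.sub (.reg 0) (.reg 1)) + 1)) (by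
        rintro _ rfl
        exact hloop)
    refine h1.mono ?_ (fun s' h => ⟨h.1, h.2.2⟩)
    simp only [Program.ticks, Expr.cost, Nat.sub_zero]
    have := Nat.mul_le_mul_right (1 + 1 + 1 + 1 + (body.ticks + 4)) hn
    have h2 : M * (body.ticks + 14) = M * (1 + 1 + 1 + 1 + (body.ticks + 4)) + 6 * M := by ring
    omega
  · rintro i s' ⟨hf, hi, hI⟩ hlt
    have hreg := (hs.of_frame hf).reg
    obtain ⟨h1, h2, h3, h4, h5⟩ := hstep i hlt s' hI hi hf
    refine ⟨by simp [Expr.Fits, hreg, hi]; omega, by simp [Expr.eval, hreg, hi]; omega, ?_⟩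
    refine (Program.runs_exec body s' h1).seq ?_
    rintro _ rfl
    refine Program.runs_of_exec ?_ (by simp [Program.ticks, Expr.cost]) ⟨?_, ?_, h5⟩
    · simp only [Program.Fits, Expr.Fits, Expr.eval, h2, hi]
      omega
    · exact Frame.setReg ⟨fun r hr => by rw [h2, hf.reg r hr], h3.trans hf.mem_zero,
        h4.trans hf.mem_one⟩ (by omega) _
    · simp [Program.exec, Expr.eval, h2, hi]
  · rintro s' ⟨hf, hi, hI⟩
    have hreg := (hs.of_frame hf).reg
    exact ⟨by simp [Expr.Fits, hreg, hi]; omega, by simp [Expr.eval, hreg, hi]⟩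

theorem runs_forNeighbors (hB : Bounds adj M W) {body : Program} {s : State} (hs : Holds adj M s)
    (y : Fin n) (h3 : s.reg 3 = y) (h4 : s.reg 4 = s.mem 0 y) (h5 : s.reg 5 = s.mem 0 (y + 1))
    (J : List (Fin n) → (ℕ → ℕ → ℕ) → Prop) (h0 : J [] s.mem)
    (hstep : ∀ (xs : List (Fin n)) (x : Fin n), xs ++ [x] <+: adj y → ∀ s', J xs s'.mem → s'.reg 3 = (y : ℕ) → s'.reg 6 = (x : ℕ) →
      Frame s s' →
      body.Fits W s' ∧ (body.exec s').reg = s'.reg ∧ (body.exec s').mem 0 = s'.mem 0 ∧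
        (body.exec s').mem 1 = s'.mem 1 ∧ J (xs ++ [x]) (body.exec s').mem) :
    Runs W ((adj y).length * (body.ticks + 11) + 4) (forNeighbors body) s
      fun s' => Frame s s' ∧ s'.reg 2 = s.reg 2 ∧ J (adj y) s'.mem := by
  have hw := hB.word
  have hn := hB.le
  have hpos := hB.pos
  have hsucc := hs.offset_succ y
  have hle := hs.offset_le (y + 1) y.2
  have hloop := runs_while_count (W := W) (B := body.ticks + 7) (N := (adj y).length)
    (e := .sub (.reg 5) (.reg 4))
    (P := .seq (.assign 6 (.load 1 (.reg 4))) (.seq body (.assign 4 (.add (.reg 4) (.const 1)))))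
    (fun i s' => Frame s s' ∧ s'.reg 2 = s.reg 2 ∧ s'.reg 3 = y ∧ s'.reg 4 = s.mem 0 y + i ∧
      s'.reg 5 = s.mem 0 (y + 1) ∧ J ((adj y).take i) s'.mem) ?_ ?_
    (Nat.zero_le _) (s := s) ⟨Frame.refl s, rfl, h3, h4, h5, h0⟩
  · refine hloop.mono ?_ (fun s' h => ⟨h.1, h.2.1, ?_⟩)
    · simp only [Expr.cost, Nat.sub_zero]
      have h2 : 1 + 1 + 1 + 1 + (body.ticks + 7) = body.ticks + 11 := by omega
      rw [h2]
    · simpa using h.2.2.2.2.2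
  · rintro i s' ⟨hf, h2', h3', h4', h5', hJ⟩ hlt
    have hs' := hs.of_frame hf
    have hent : s'.mem 1 (s.mem 0 y + i) = (adj y)[i] := by
      rw [hf.mem_one]
      exact hs.entry y i hlt
    have hx : ((adj y)[i] : ℕ) < n := ((adj y)[i]).2
    have htake : (adj y).take (i + 1) = (adj y).take i ++ [(adj y)[i]] := by simp
    refine ⟨by simp [Expr.Fits, h4', h5']; omega, by simp [Expr.eval, h4', h5']; omega, ?_⟩
    have hf' : Frame s (s'.setReg 6 (adj y)[i]) := hf.setReg (by omega) _
    obtain ⟨g1, g2, g3, g4, g5⟩ := hstep ((adj y).take i) (adj y)[i]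
      (by rw [← htake]; exact List.take_prefix _ _) (s'.setReg 6 (adj y)[i]) hJ (by simp [h3'])
      (by simp) hf'
    have hr := Runs.seq (Program.runs_exec (W := W) (.assign 6 (.load 1 (.reg 4))) s'
      (by simp [Program.Fits, Expr.Fits, Expr.eval, h4', hent]; omega))
      (P₂ := .seq body (.assign 4 (.add (.reg 4) (.const 1)))) (T₂ := body.ticks + 4)
      (Q := fun s' => Frame s s' ∧ s'.reg 2 = s.reg 2 ∧ s'.reg 3 = y ∧
        s'.reg 4 = s.mem 0 y + (i + 1) ∧
        s'.reg 5 = s.mem 0 (y + 1) ∧ J ((adj y).take (i + 1)) s'.mem) (by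
        rintro _ rfl
        simp only [Program.exec, Expr.eval, h4', hent]
        refine (Program.runs_exec body _ g1).seq ?_
        rintro _ rfl
        refine Program.runs_of_exec ?_ (by simp [Program.ticks, Expr.cost])
          ⟨?_, ?_, ?_, ?_, ?_, ?_⟩
        · simp [Program.Fits, Expr.Fits, Expr.eval, g2, h4']
          omega
        · exact Frame.setReg ⟨fun r hr => by rw [g2, hf'.reg r hr], g3.trans hf'.mem_zero,
            g4.trans hf'.mem_one⟩ (by omega) _
        · simp [Program.exec, g2, h2']
        · simp [Program.exec, g2, h3']
        · simp [Program.exec, Expr.eval, g2, h4', add_assoc]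
        · simp [Program.exec, g2, h5']
        · rw [htake]
          exact g5)
    refine hr.mono ?_ (fun _ h => h)
    simp only [Program.ticks, Expr.cost]
    omega
  · rintro s' ⟨hf, h2', h3', h4', h5', hJ⟩
    exact ⟨by simp [Expr.Fits, h4', h5']; omega, by simp [Expr.eval, h4', h5']; omega⟩

/-- The array `2` may grow during the loop, as a search queue does; only the next entry has to be a
new vertex when it is read. -/
theorem runs_scan (hB : Bounds adj M W) {body : Program} {s : State} (hs : Holds adj M s)
    (I : List (Fin n) → (ℕ → ℕ → ℕ) → Prop)
    (J : List (Fin n) → Fin n → List (Fin n) → (ℕ → ℕ → ℕ) → Prop) (h0 : I [] s.mem)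
    (hbegin : ∀ ys μ, I ys μ → ys.Nodup → ys.length < n →
      ∃ y ∉ ys, μ 2 ys.length = y ∧ J ys y [] μ)
    (hstep : ∀ (ys : List (Fin n)) (y : Fin n) (xs : List (Fin n)) (x : Fin n),
      xs ++ [x] <+: adj y → ∀ s', J ys y xs s'.mem → s'.reg 3 = (y : ℕ) →
      s'.reg 6 = (x : ℕ) → Frame s s' →
      body.Fits W s' ∧ (body.exec s').reg = s'.reg ∧ (body.exec s').mem 0 = s'.mem 0 ∧
        (body.exec s').mem 1 = s'.mem 1 ∧ J ys y (xs ++ [x]) (body.exec s').mem)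
    (hend : ∀ ys y μ, J ys y (adj y) μ → I (ys ++ [y]) μ) :
    Runs W (M * (2 * body.ticks + 51)) (scan body) s
      fun s' => Frame s s' ∧ ∃ ys : List (Fin n), ys.Nodup ∧ ys.length = n ∧ I ys s'.mem := by
  have hn := hB.le
  have hw := hB.word
  have hpos := hB.pos
  have hsum := hB.sum_le
  -- The full price of the round of `v`, outer test included. The credit is the sum over unprocessed
  -- vertices, so the total is governed by the sum of the degrees.
  let A : Fin n → ℕ := fun v => (adj v).length * (body.ticks + 11) + 23
  have hloop := runs_while (W := W) (e := .sub (.reg 0) (.reg 2))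
    (P := .seq (.assign 3 (.load 2 (.reg 2))) (.seq (.assign 4 (.load 0 (.reg 3)))
      (.seq (.assign 5 (.load 0 (.add (.reg 3) (.const 1))))
        (.seq (forNeighbors body) (.assign 2 (.add (.reg 2) (.const 1)))))))
    (Q := fun s' => Frame s s' ∧ ∃ ys : List (Fin n), ys.Nodup ∧ ys.length = n ∧ I ys s'.mem)
    (fun s' T => ∃ ys : List (Fin n), ys.Nodup ∧ I ys s'.mem ∧ Frame s s' ∧
      s'.reg 2 = ys.length ∧ T = ∑ v ∈ Finset.univ \ ys.toFinset, A v + 4) ?_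
    (s := s.setReg 2 0) ⟨[], List.nodup_nil, h0, (Frame.refl s).setReg (by omega) 0, by simp, rfl⟩
  · have h1 := Runs.seq (Program.runs_exec (W := W) (.assign 2 (.const 0)) s
      (by simp [Program.Fits, Expr.Fits])) (by
        rintro _ rfl
        exact hloop)
    refine h1.mono ?_ (fun s' h => h)
    simp only [Program.ticks, Expr.cost, List.toFinset_nil, Finset.sdiff_empty, A,
      Finset.sum_add_distrib, ← Finset.sum_mul, Finset.sum_const, Finset.card_univ,
      Fintype.card_fin, smul_eq_mul]
    have := Nat.mul_le_mul_right (body.ticks + 11) hsum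
    have h2 : M * (2 * body.ticks + 51) = 2 * M * (body.ticks + 11) + 29 * M := by ring
    omega
  · rintro s' _ ⟨ys, hys, hI, hf, h2, rfl⟩
    have hs' := hs.of_frame hf
    have hreg := hs'.reg
    have hlen : ys.length ≤ n := by simpa using hys.length_le_card
    refine ⟨by simp [Expr.Fits, hreg, h2]; omega,
      fun h => ⟨by simp [Expr.cost], hf, ys, hys, ?_, hI⟩, fun h => ?_⟩
    · simp [Expr.eval, hreg, h2] at h
      omega
    have hlt : ys.length < n := by
      simp [Expr.eval, hreg, h2] at h
      omega
    obtain ⟨y, hy, hmem, hJ⟩ := hbegin ys s'.mem hI hys hlt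
    have hoff := hs'.offset_le y y.2.le
    have hoff' := hs'.offset_le (y + 1) y.2
    let s₁ := ((s'.setReg 3 y).setReg 4 (s'.mem 0 y)).setReg 5 (s'.mem 0 (y + 1))
    have hf₁ : Frame s s₁ := ((hf.setReg (by omega) _).setReg (by omega) _).setReg (by omega) _
    have hb := runs_forNeighbors hB (hs.of_frame hf₁) (body := body) y (by simp [s₁])
      (by simp [s₁]) (by simp [s₁]) (J ys y) (by simpa [s₁] using hJ)
      (fun xs x hx s'' hJ' h3 h6 hf' => hstep ys y xs x hx s'' hJ' h3 h6 (hf₁.trans hf'))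
    have hfin : ∀ s'', Frame s₁ s'' ∧ s''.reg 2 = s₁.reg 2 ∧ J ys y (adj y) s''.mem →
        Runs W 4 (.assign 2 (.add (.reg 2) (.const 1))) s'' fun s'' =>
          ∃ ys' : List (Fin n), ys'.Nodup ∧ I ys' s''.mem ∧ Frame s s'' ∧ s''.reg 2 = ys'.length ∧
            ∑ v ∈ Finset.univ \ (ys ++ [y]).toFinset, A v + 4 =
              ∑ v ∈ Finset.univ \ ys'.toFinset, A v + 4 := by
      rintro s'' ⟨g1, g2, g3⟩
      have g2' : s''.reg 2 = ys.length := by simpa [s₁, h2] using g2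
      refine Program.runs_of_exec ?_ (by simp [Program.ticks, Expr.cost])
        ⟨ys ++ [y], ?_, hend ys y _ g3, (hf₁.trans g1).setReg (by omega) _, ?_, rfl⟩
      · simp [Program.Fits, Expr.Fits, Expr.eval, g2']
        omega
      · rw [List.nodup_append]
        refine ⟨hys, List.nodup_singleton y, ?_⟩
        rintro a ha b hb rfl
        exact hy (List.mem_singleton.1 hb ▸ ha)
      · simp [Program.exec, Expr.eval, g2']
    have hsumy : ∑ v ∈ Finset.univ \ ys.toFinset, A v =
        A y + ∑ v ∈ Finset.univ \ (ys ++ [y]).toFinset, A v := by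
      rw [← Finset.add_sum_erase _ A (a := y) (by simpa using hy)]
      congr 2
      ext v
      simp [not_or]
    refine ⟨A y - 4, ∑ v ∈ Finset.univ \ (ys ++ [y]).toFinset, A v + 4, ?_, ?_⟩
    · rw [hsumy]
      simp only [Expr.cost, A]
      omega
    have hA : A y - 4 = 3 + (3 + (5 + (((adj y).length * (body.ticks + 11) + 4) + 4))) := by
      simp only [A]
      omega
    rw [hA]
    refine (Program.runs_exec (W := W) (.assign 3 (.load 2 (.reg 2))) s' (by
      simp [Program.Fits, Expr.Fits, Expr.eval, h2, hmem]; omega)).seq ?_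
    rintro _ rfl
    simp only [Program.exec, Expr.eval, h2, hmem]
    refine (Program.runs_exec (W := W) (.assign 4 (.load 0 (.reg 3))) _ (by
      simp [Program.Fits, Expr.Fits, Expr.eval]; omega)).seq ?_
    rintro _ rfl
    simp only [Program.exec, Expr.eval, State.setReg_reg, State.setReg_mem, Function.update_self]
    refine (Program.runs_exec (W := W) (.assign 5 (.load 0 (.add (.reg 3) (.const 1)))) _ (by
      simp [Program.Fits, Expr.Fits, Expr.eval]; omega)).seq ?_
    rintro _ rfl
    have hs₁ : Program.exec (.assign 5 (.load 0 (.add (.reg 3) (.const 1))))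
        ((s'.setReg 3 y).setReg 4 (s'.mem 0 y)) = s₁ := by
      simp [Program.exec, Expr.eval, s₁]
    rw [hs₁]
    exact hb.seq hfin

end RAM

namespace RAM

/-! ## Breadth-first search -/

/-- Appends the value of `e` to the queue in the array `2`, whose length is in the array `10`. -/
def enqueue (e : Expr) : Program :=
  .seq (.store 2 (.load 10 (.const 0)) e)
    (.store 10 (.const 0) (.add (.load 10 (.const 0)) (.const 1)))

/-- Breadth-first search from the set marked in the array `11`. The array `d` receives the levels
increased by `1`, and the array `2` the vertices in the order of the search. -/
def bfs (d : ℕ) : Program :=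
  .seq (.store 10 (.const 0) (.const 0))
    (.seq (forVertices (.ifNonzero (.load 11 (.reg 1))
        (.seq (.store d (.reg 1) (.const 1)) (enqueue (.reg 1)))
        (.store d (.reg 1) (.const 0))))
      (scan (.ifNonzero (.load d (.reg 6)) .skip
        (.seq (.store d (.reg 6) (.add (.load d (.reg 3)) (.const 1))) (enqueue (.reg 6))))))

variable {n : ℕ} {adj : Fin n → List (Fin n)} {M W : ℕ} {G : SimpleGraph (Fin n)}

/-- The array `f` is the characteristic function of `K`. -/
def Marks (K : Set (Fin n)) (f : ℕ → ℕ) : Prop := ∀ v : Fin n, (v ∈ K → f v = 1) ∧ (v ∉ K → f v = 0)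

/-- The queue holds the list `q`. -/
structure Queue (q : List (Fin n)) (μ : ℕ → ℕ → ℕ) : Prop where
  length : μ 10 0 = q.length
  entry : ∀ (j : ℕ) (h : j < q.length), μ 2 j = q[j]

theorem Queue.push {q : List (Fin n)} {μ μ' : ℕ → ℕ → ℕ} (h : Queue q μ) (x : Fin n)
    (h2 : μ' 2 = Function.update (μ 2) q.length x) (h10 : μ' 10 0 = q.length + 1) :
    Queue (q ++ [x]) μ' where
  length := by simp [h10]
  entry j hj := by
    rw [h2]
    rcases Nat.lt_or_ge j q.length with hlt | hge
    · rw [Function.update_of_ne (by omega), h.entry j hlt, List.getElem_append_left hlt]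
    · have : j = q.length := by simp at hj; omega
      subst this
      simp

/-- All smaller levels are inhabited. This keeps stored levels within the word bound. -/
theorem _root_.SimpleGraph.IsLevel.lt_card {K : Set (Fin n)} {lev : Fin n → ℕ}
    (hl : G.IsLevel K lev) (x : Fin n) : lev x < n := by
  have key : ∀ l x, lev x = l → ∀ k ≤ l, ∃ y, lev y = k := by
    intro l
    induction l with
    | zero =>
      intro x hx k hk
      exact ⟨x, by omega⟩
    | succ l ih =>
      intro x hx k hk
      rcases hk.lt_or_eq with h | rfl
      · obtain ⟨y, -, hy⟩ := hl.exists_adj x l hx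
        exact ih y hy k (by omega)
      · exact ⟨x, hx⟩
  have hsub : Finset.range (lev x + 1) ⊆ Finset.univ.image lev := by
    intro k hk
    obtain ⟨y, hy⟩ := key _ x rfl k (by simpa [Nat.lt_succ_iff] using hk)
    exact Finset.mem_image.2 ⟨y, Finset.mem_univ _, hy⟩
  have := (Finset.card_le_card hsub).trans Finset.card_image_le
  simpa using this

/-- The array `d` holds the levels, increased by `1`, of the vertices of `q`. -/
def Levels (lev : Fin n → ℕ) (q : List (Fin n)) (f : ℕ → ℕ) : Prop :=
  ∀ v : Fin n, (v ∈ q → f v = lev v + 1) ∧ (v ∉ q → f v = 0)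

/-- The invariant of the breadth-first search: the vertices of `ys` have been processed, and those
of `rest` are waiting. -/
structure BfsInv (G : SimpleGraph (Fin n)) (K : Set (Fin n)) (lev : Fin n → ℕ) (d : ℕ)
    (ys rest : List (Fin n)) (μ : ℕ → ℕ → ℕ) : Prop where
  nodup : (ys ++ rest).Nodup
  sorted : (ys ++ rest).Pairwise fun a b => lev a ≤ lev b
  queue : Queue (ys ++ rest) μ
  levels : Levels lev (ys ++ rest) (μ d)
  source : ∀ v, lev v = 0 → v ∈ ys ++ rest
  bound : ∀ y ∈ rest, ∀ x ∈ ys ++ rest, lev x ≤ lev y + 1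
  closed : ∀ y ∈ ys, ∀ x, G.Adj y x → x ∈ ys ++ rest

section

variable {K : Set (Fin n)} {lev : Fin n → ℕ} {d : ℕ} {ys rest : List (Fin n)} {y : Fin n}
  {μ μ' : ℕ → ℕ → ℕ}

/-- An inner neighbour of `x` has level below that of `y`, so in the sorted queue it precedes `y`:
it has been processed and has put `x` into the queue. -/
theorem BfsInv.mem_of_lev_le (h : BfsInv G K lev d ys (y :: rest) μ) (hl : G.IsLevel K lev)
    {x : Fin n} (hx : lev x ≤ lev y) : x ∈ ys ++ y :: rest := by
  induction hk : lev x generalizing x with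
  | zero => exact h.source x hk
  | succ l ih =>
    obtain ⟨x', hxx', hx'⟩ := hl.exists_adj x l hk
    rcases List.mem_append.1 (ih (by omega) hx') with h1 | h1
    · exact h.closed x' h1 x hxx'.symm
    · have h2 := (List.pairwise_append.1 h.sorted).2.1
      rcases List.mem_cons.1 h1 with rfl | h1
      · omega
      · have := (List.pairwise_cons.1 h2).1 x' h1
        omega

theorem BfsInv.mem_of_rest_nil (h : BfsInv G K lev d ys [] μ) (hl : G.IsLevel K lev)
    (x : Fin n) : x ∈ ys := by
  induction hk : lev x generalizing x with
  | zero => simpa using h.source x hk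
  | succ l ih =>
    obtain ⟨x', hxx', hx'⟩ := hl.exists_adj x l hk
    simpa using h.closed x' (ih x' hx') x hxx'.symm

/-- A newly found `x` has level exactly `lev y + 1`, as smaller levels are already queued. The
stored value is one more than that. -/
theorem BfsInv.push (h : BfsInv G K lev d ys (y :: rest) μ) (hl : G.IsLevel K lev) {x : Fin n}
    (hyx : G.Adj y x) (hx : x ∉ ys ++ y :: rest) (hq : Queue (ys ++ y :: (rest ++ [x])) μ')
    (hd : μ' d = Function.update (μ d) x (lev y + 2)) :
    BfsInv G K lev d ys (y :: (rest ++ [x])) μ' := by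
  have hlev : lev x = lev y + 1 := by
    have h1 := hl.le_add_one y x hyx
    have h2 := mt (h.mem_of_lev_le hl) hx
    omega
  have heq : ys ++ y :: (rest ++ [x]) = (ys ++ y :: rest) ++ [x] := by simp
  have hle : ∀ z ∈ ys ++ y :: rest, lev z ≤ lev x := fun z hz => by
    have := h.bound y (by simp) z hz
    omega
  have hrest : ∀ z ∈ y :: rest, lev y ≤ lev z := by
    have h2 := (List.pairwise_cons.1 (List.pairwise_append.1 h.sorted).2.1).1
    intro z hz
    rcases List.mem_cons.1 hz with rfl | hz
    · exact le_rfl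
    · exact h2 z hz
  refine ⟨?_, ?_, hq, ?_, ?_, ?_, ?_⟩
  · rw [heq, List.nodup_append]
    refine ⟨h.nodup, List.nodup_singleton x, ?_⟩
    rintro a ha b hb rfl
    exact hx (List.mem_singleton.1 hb ▸ ha)
  · rw [heq, List.pairwise_append]
    exact ⟨h.sorted, List.pairwise_singleton _ _, fun a ha b hb => by
      rw [List.mem_singleton.1 hb]
      exact hle a ha⟩
  · rw [heq, hd]
    intro v
    by_cases hv : v = x
    · subst hv
      simp [hlev]
    · have hv' : (v : ℕ) ≠ x := fun h => hv (Fin.ext h)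
      rw [Function.update_of_ne hv', List.mem_append, List.mem_singleton]
      simpa [hv] using h.levels v
  · intro v hv
    rw [heq]
    exact List.mem_append_left _ (h.source v hv)
  · rw [heq]
    intro z hz w hw
    have hz' : z ∈ y :: rest ∨ z = x := by
      rw [← List.cons_append, List.mem_append, List.mem_singleton] at hz
      exact hz
    rw [List.mem_append, List.mem_singleton] at hw
    rcases hz' with hz' | rfl
    · rcases hw with hw | rfl
      · exact h.bound z hz' w hw
      · have := hrest z hz'
        omega
    · rcases hw with hw | rfl
      · have := hle w hw
        omega
      · omega
  · intro z hz w hw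
    rw [heq]
    exact List.mem_append_left _ (h.closed z hz w hw)

end

/-- Only the arrays from `2` on that belong to the list `as` have changed. -/
def MemFrame (as : List ℕ) (μ μ' : ℕ → ℕ → ℕ) : Prop := ∀ a ∉ as, μ' a = μ a

/-- The outcome of a breadth-first search. -/
structure Searched (K : Set (Fin n)) (lev : Fin n → ℕ) (d : ℕ) (q : List (Fin n))
    (μ : ℕ → ℕ → ℕ) : Prop where
  nodup : q.Nodup
  length : q.length = n
  sorted : q.Pairwise fun a b => lev a ≤ lev b
  entry : ∀ (j : ℕ) (h : j < q.length), μ 2 j = q[j]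
  levels : ∀ v : Fin n, μ d v = lev v + 1

theorem runs_bfs (hB : Bounds adj M W) (hadj : IsAdjacencyLists G adj) {K : Set (Fin n)}
    {lev : Fin n → ℕ} (hl : G.IsLevel K lev) {d : ℕ} (hd : 3 ≤ d ∧ d ≤ 5) {s : State}
    (hs : Holds adj M s) (hK : Marks K (s.mem 11)) :
    Runs W (200 * M) (bfs d) s fun s' => Frame s s' ∧ MemFrame [2, d, 10] s.mem s'.mem ∧
      ∃ q, Searched K lev d q s'.mem := by
  have hn := hB.le
  have hw := hB.word
  have hpos := hB.pos
  have d0 : d ≠ 0 := by omega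
  have d1 : d ≠ 1 := by omega
  have d2 : d ≠ 2 := by omega
  have d10 : d ≠ 10 := by omega
  have d11 : d ≠ 11 := by omega
  have hsplit : 200 * M = 3 * M + (M * 54 + 143 * M) := by ring
  rw [hsplit]
  refine ((Program.runs_exec (W := W) (.store 10 (.const 0) (.const 0)) s
    (by simp [Program.Fits, Expr.Fits])).mono (by simp [Program.ticks, Expr.cost]; omega)
    fun _ h => h).seq ?_
  rintro _ rfl
  set s₁ := Program.exec (.store 10 (.const 0) (.const 0)) s with hs₁
  have hf₁ : Frame s s₁ := ⟨fun _ _ => rfl, rfl, rfl⟩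
  refine Runs.seq (R := fun s' => (Frame s₁ s' ∧
    ∃ q : List (Fin n), q.Nodup ∧ (∀ v, v ∈ q ↔ v ∈ K) ∧ Queue q s'.mem ∧
      (∀ v : Fin n, (v ∈ K → s'.mem d v = 1) ∧ (v ∉ K → s'.mem d v = 0)) ∧
      MemFrame [2, d, 10] s.mem s'.mem)) ?_ ?_
  · refine (runs_forVertices hB (hs.of_frame hf₁) (fun i μ =>
      ∃ q : List (Fin n), q.Nodup ∧ (∀ v, v ∈ q ↔ (v : ℕ) < i ∧ v ∈ K) ∧ Queue q μ ∧
        (∀ v : Fin n, (v : ℕ) < i → (v ∈ K → μ d v = 1) ∧ (v ∉ K → μ d v = 0)) ∧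
        MemFrame [2, d, 10] s.mem μ) ?_ ?_).mono ?_ ?_
    · refine ⟨[], List.nodup_nil, by simp, ⟨by simp [s₁, Program.exec, Expr.eval], by simp⟩,
        by simp, ?_⟩
      intro a ha
      simp only [List.mem_cons, List.not_mem_nil, or_false, not_or] at ha
      simp [s₁, Program.exec, ha.2.2]
    · rintro i hi s' ⟨q, hnd, hmem, hq, hlev, hfr⟩ h1 hf
      have h11 : s'.mem 11 = s.mem 11 := hfr 11 (by simp [d11.symm])
      have hlen : q.length ≤ n := by simpa using hnd.length_le_card
      have hlen' := hq.length
      set v : Fin n := ⟨i, hi⟩ with hv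
      by_cases hvK : v ∈ K
      · have hval : s'.mem 11 i = 1 := by rw [h11]; exact (hK v).1 hvK
        have hvq : v ∉ q := fun h => by simpa [hv] using (hmem v).1 h
        refine ⟨?_, ?_, ?_, ?_, q ++ [v], ?_, ?_, ?_, ?_, ?_⟩
        · simp [Program.Fits, Expr.Fits, Expr.eval, Program.exec, enqueue, h1, hval, d10.symm,
            hlen', d2.symm]
          omega
        · simp [Program.exec, Expr.eval, h1, hval, enqueue]
        · simp [Program.exec, Expr.eval, h1, hval, enqueue, d0.symm]
        · simp [Program.exec, Expr.eval, h1, hval, enqueue, d1.symm]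
        · rw [List.nodup_append]
          refine ⟨hnd, List.nodup_singleton v, ?_⟩
          rintro a ha b hb rfl
          exact hvq (List.mem_singleton.1 hb ▸ ha)
        · intro w
          rw [List.mem_append, List.mem_singleton, hmem w]
          constructor
          · rintro (⟨h, h'⟩ | rfl)
            · exact ⟨by omega, h'⟩
            · exact ⟨by simp [hv], hvK⟩
          · rintro ⟨h, h'⟩
            rcases Nat.lt_succ_iff_lt_or_eq.1 h with h | h
            · exact Or.inl ⟨h, h'⟩
            · exact Or.inr (Fin.ext h)
        · refine hq.push v ?_ ?_
          · simp [Program.exec, Expr.eval, h1, hval, enqueue, d2.symm, d10.symm, hlen', hv]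
          · simp [Program.exec, Expr.eval, h1, hval, enqueue, d10.symm, hlen']
        · intro w hw
          simp only [Program.exec, Expr.eval, h1, hval, enqueue, ne_eq, one_ne_zero,
            not_false_eq_true, if_true, State.setMem_mem, State.setMem_reg, Function.update_of_ne d2,
            Function.update_of_ne d10, Function.update_self]
          by_cases hwi : (w : ℕ) = i
          · have : w = v := Fin.ext hwi
            rw [hwi, Function.update_self, this]
            exact ⟨fun _ => rfl, fun h => absurd hvK h⟩
          · rw [Function.update_of_ne hwi]
            exact hlev w (by omega)
        · intro a ha
          rw [← hfr a ha]
          simp only [List.mem_cons, List.not_mem_nil, or_false, not_or] at ha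
          simp [Program.exec, Expr.eval, h1, hval, enqueue, ha.1, ha.2.1, ha.2.2]
      · have hval : s'.mem 11 i = 0 := by rw [h11]; exact (hK v).2 hvK
        refine ⟨?_, ?_, ?_, ?_, q, hnd, ?_, ?_, ?_, ?_⟩
        · simp [Program.Fits, Expr.Fits, Expr.eval, h1, hval]
          omega
        · simp [Program.exec, Expr.eval, h1, hval]
        · simp [Program.exec, Expr.eval, h1, hval, d0.symm]
        · simp [Program.exec, Expr.eval, h1, hval, d1.symm]
        · intro w
          rw [hmem w]
          constructor
          · rintro ⟨h, h'⟩
            exact ⟨by omega, h'⟩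
          · rintro ⟨h, h'⟩
            rcases Nat.lt_succ_iff_lt_or_eq.1 h with h | h
            · exact ⟨h, h'⟩
            · exact absurd ((Fin.ext h : w = v) ▸ h') hvK
        · exact ⟨by simpa [Program.exec, Expr.eval, h1, hval, d10.symm] using hq.length,
            by simpa [Program.exec, Expr.eval, h1, hval, d2.symm] using hq.entry⟩
        · intro w hw
          simp only [Program.exec, Expr.eval, h1, hval, ne_eq, not_true_eq_false, if_false,
            State.setMem_mem, Function.update_self]
          by_cases hwi : (w : ℕ) = i
          · have : w = v := Fin.ext hwi
            rw [hwi, Function.update_self, this]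
            exact ⟨fun h => absurd h hvK, fun _ => rfl⟩
          · rw [Function.update_of_ne hwi]
            exact hlev w (by omega)
        · intro a ha
          rw [← hfr a ha]
          simp only [List.mem_cons, List.not_mem_nil, or_false, not_or] at ha
          simp [Program.exec, Expr.eval, h1, hval, ha.2.1]
    · simp [Program.ticks, Expr.cost, enqueue]
      omega
    · rintro s' ⟨hf, q, hnd, hmem, hq, hlev, hfr⟩
      exact ⟨hf, q, hnd, fun v => by simp [hmem v], hq, fun v => hlev v v.2, hfr⟩
  · rintro s₂ ⟨hf₂, q, hnd, hmem, hq, hlev, hfr⟩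
    have hf₂' := hf₁.trans hf₂
    refine (runs_scan hB (hs.of_frame hf₂') (fun ys μ => MemFrame [2, d, 10] s.mem μ ∧
      ∃ rest, BfsInv G K lev d ys rest μ)
      (fun ys y xs μ => MemFrame [2, d, 10] s.mem μ ∧
        ∃ rest, BfsInv G K lev d ys (y :: rest) μ ∧ ∀ x ∈ xs, x ∈ ys ++ y :: rest)
      ?_ ?_ ?_ ?_).mono ?_ ?_
    · have hq0 : ∀ v ∈ q, lev v = 0 := fun v hv => (hl.eq_zero_iff v).2 ((hmem v).1 hv)
      refine ⟨hfr, q, hnd, ?_, hq, ?_, ?_, ?_, by simp⟩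
      · exact List.pairwise_of_forall_mem_list fun a ha b hb => by
          rw [hq0 a ha, hq0 b hb]
      · intro v
        rw [List.nil_append]
        refine ⟨fun hv => ?_, fun hv => (hlev v).2 (mt (hmem v).2 hv)⟩
        rw [hq0 v hv]
        exact (hlev v).1 ((hmem v).1 hv)
      · intro v hv
        exact (hmem v).2 ((hl.eq_zero_iff v).1 hv)
      · intro y _ x hx
        rw [hq0 x hx]
        omega
    · rintro ys μ ⟨hfr, rest, h⟩ hys hlt
      cases rest with
      -- An exhausted queue is closed under adjacency and contains the source, so it already has all
      -- `n` vertices.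
      | nil =>
        have h1 := h.mem_of_rest_nil hl
        have h2 : (Finset.univ : Finset (Fin n)) ⊆ ys.toFinset := fun x _ => by simpa using h1 x
        have h3 := (Finset.card_le_card h2).trans ys.toFinset_card_le
        simp at h3
        omega
      | cons y rest =>
        refine ⟨y, ?_, ?_, hfr, rest, h, by simp⟩
        · intro hy
          exact (List.nodup_append.1 h.nodup).2.2 y hy y (by simp) rfl
        · have := h.queue.entry ys.length (by simp)
          simpa using this
    · rintro ys y xs x hx s' ⟨hfr, rest, h, hxs⟩ h3 h6 hf
      have hyx : G.Adj y x := (hadj y).2 x |>.1 (hx.subset (by simp))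
      have hlen : (ys ++ y :: rest).length ≤ n := by simpa using h.nodup.length_le_card
      have hlen' := h.queue.length
      have hly : s'.mem d y = lev y + 1 := (h.levels y).1 (by simp)
      have hlt := hl.lt_card y
      have hltx := hl.lt_card x
      by_cases hxq : x ∈ ys ++ y :: rest
      · have hval : s'.mem d x = lev x + 1 := (h.levels x).1 hxq
        have hexec : Program.exec (.ifNonzero (.load d (.reg 6)) .skip
            (.seq (.store d (.reg 6) (.add (.load d (.reg 3)) (.const 1)))
              (enqueue (.reg 6)))) s' = s' := by
          simp [Program.exec, Expr.eval, h6, hval]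
        rw [hexec]
        refine ⟨?_, rfl, rfl, rfl, hfr, rest, h, ?_⟩
        · simp [Program.Fits, Expr.Fits, Expr.eval, h6, hval]
          omega
        · intro z hz
          rcases List.mem_append.1 hz with hz | hz
          · exact hxs z hz
          · exact List.mem_singleton.1 hz ▸ hxq
      · have hval : s'.mem d x = 0 := (h.levels x).2 hxq
        refine ⟨?_, ?_, ?_, ?_, ?_, rest ++ [x], ?_, ?_⟩
        · simp [Program.Fits, Expr.Fits, Expr.eval, Program.exec, enqueue, h3, h6, hval, d10.symm,
            d2.symm, hlen', hly]
          simp at hlen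
          omega
        · simp [Program.exec, Expr.eval, h3, h6, hval, enqueue]
        · simp [Program.exec, Expr.eval, h3, h6, hval, enqueue, d0.symm]
        · simp [Program.exec, Expr.eval, h3, h6, hval, enqueue, d1.symm]
        · intro a ha
          rw [← hfr a ha]
          simp only [List.mem_cons, List.not_mem_nil, or_false, not_or] at ha
          simp [Program.exec, Expr.eval, h6, hval, enqueue, ha.1, ha.2.1, ha.2.2]
        · refine h.push hl hyx hxq ?_ ?_
          · have := h.queue.push (μ' := (Program.exec (.ifNonzero (.load d (.reg 6)) .skip
              (.seq (.store d (.reg 6) (.add (.load d (.reg 3)) (.const 1)))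
                (enqueue (.reg 6)))) s').mem) x ?_ ?_
            · simpa using this
            · simp [Program.exec, Expr.eval, h6, hval, enqueue, d2.symm, d10.symm, hlen']
            · simp [Program.exec, Expr.eval, h6, hval, enqueue, d10.symm, hlen']
          · simp [Program.exec, Expr.eval, h3, h6, hval, enqueue, d2, d10, hly]
        · intro z hz
          have heq : ys ++ y :: (rest ++ [x]) = (ys ++ y :: rest) ++ [x] := by simp
          rw [heq]
          rcases List.mem_append.1 hz with hz | hz
          · exact List.mem_append_left _ (hxs z hz)
          · exact List.mem_append_right _ hz
    · rintro ys y μ ⟨hfr, rest, h, hxs⟩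
      have heq : ys ++ [y] ++ rest = ys ++ y :: rest := by simp
      refine ⟨hfr, rest, ?_, ?_, ?_, ?_, ?_, ?_, ?_⟩
      · rw [heq]; exact h.nodup
      · rw [heq]; exact h.sorted
      · rw [heq]; exact h.queue
      · rw [heq]; exact h.levels
      · rw [heq]; exact h.source
      · rw [heq]; exact fun z hz => h.bound z (List.mem_cons_of_mem _ hz)
      · rw [heq]
        intro z hz x hx
        rcases List.mem_append.1 hz with hz | hz
        · exact h.closed z hz x hx
        · rw [List.mem_singleton.1 hz] at hx
          exact hxs x (((hadj y).2 x).2 hx)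
    · simp [Program.ticks, Expr.cost, enqueue]
      omega
    · rintro s' ⟨hf, ys, hys, hlen, hfr, rest, h⟩
      have h1 : (ys ++ rest).length ≤ n := by simpa using h.nodup.length_le_card
      have h2 : rest = [] := by
        rw [List.length_append] at h1
        exact List.eq_nil_of_length_eq_zero (by omega)
      subst h2
      have h3 := h.queue.entry
      have h4 := h.sorted
      have h5 := h.levels
      simp only [List.append_nil] at h3 h4 h5
      exact ⟨hf₂'.trans hf, hfr, ys, hys, hlen, h4, h3,
        fun v => (h5 v).1 (h.mem_of_rest_nil hl v)⟩

end RAM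

namespace RAM

variable {n : ℕ} {adj : Fin n → List (Fin n)} {M W : ℕ} {G : SimpleGraph (Fin n)}

theorem MemFrame.trans {as bs : List ℕ} {μ μ' μ'' : ℕ → ℕ → ℕ} (h : MemFrame as μ μ')
    (h' : MemFrame bs μ' μ'') : MemFrame (as ++ bs) μ μ'' := fun a ha => by
  rw [List.mem_append, not_or] at ha
  exact (h' a ha.2).trans (h a ha.1)

/-! ## Filling and accumulating arrays -/

/-- Stores the value of `e`, which may depend on the vertex in the register `1`, for every vertex. -/
def mapArray (a : ℕ) (e : Expr) : Program := forVertices (.store a (.reg 1) e)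

theorem runs_mapArray (hB : Bounds adj M W) {a : ℕ} (ha : 2 ≤ a) {e : Expr} {s : State}
    (hs : Holds adj M s) (f : Fin n → ℕ)
    (he : ∀ (v : Fin n) (s' : State), s'.reg 1 = v → Frame s s' → MemFrame [a] s.mem s'.mem →
      e.Fits W s' ∧ e.eval s' = f v) {T : ℕ} (hT : e.cost + 16 ≤ T) :
    Runs W (T * M) (mapArray a e) s fun s' => Frame s s' ∧ MemFrame [a] s.mem s'.mem ∧
      ∀ v : Fin n, s'.mem a v = f v := by
  have hn := hB.le
  have hw := hB.word
  refine (runs_forVertices hB hs (fun i μ => MemFrame [a] s.mem μ ∧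
    ∀ v : Fin n, (v : ℕ) < i → μ a v = f v) ⟨fun _ _ => rfl, by simp⟩ ?_).mono ?_ ?_
  · rintro i hi s' ⟨hfr, hf⟩ h1 hframe
    obtain ⟨g1, g2⟩ := he ⟨i, hi⟩ s' h1 hframe hfr
    refine ⟨⟨?_, g1⟩, rfl, ?_, ?_, ?_, ?_⟩
    · simp only [Expr.Fits, h1]
      omega
    · simp [Program.exec, (show (0 : ℕ) ≠ a by omega)]
    · simp [Program.exec, (show (1 : ℕ) ≠ a by omega)]
    · intro b hb
      rw [← hfr b hb]
      simp only [List.mem_singleton] at hb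
      simp [Program.exec, hb]
    · intro v hv
      simp only [Program.exec, State.setMem_mem, Function.update_self, Expr.eval, h1, g2]
      by_cases hvi : (v : ℕ) = i
      · rw [hvi, Function.update_self]
        congr 1
        exact Fin.ext hvi.symm
      · rw [Function.update_of_ne hvi]
        exact hf v (by omega)
  · rw [mul_comm]
    exact Nat.mul_le_mul_right _ (by simp only [Program.ticks, Expr.cost]; omega)
  · rintro s' ⟨h1, h2, h3⟩
    exact ⟨h1, h2, fun v => h3 v v.2⟩

/-- The array `2` lists all vertices. -/
structure Ordering (q : List (Fin n)) (μ : ℕ → ℕ → ℕ) : Prop where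
  nodup : q.Nodup
  length : q.length = n
  entry : ∀ (j : ℕ) (h : j < q.length), μ 2 j = q[j]

theorem Searched.ordering {K : Set (Fin n)} {lev : Fin n → ℕ} {d : ℕ} {q : List (Fin n)}
    {μ : ℕ → ℕ → ℕ} (h : Searched K lev d q μ) : Ordering q μ := ⟨h.nodup, h.length, h.entry⟩

theorem Ordering.congr {q : List (Fin n)} {μ μ' : ℕ → ℕ → ℕ} (h : Ordering q μ)
    (h2 : μ' 2 = μ 2) : Ordering q μ' := ⟨h.nodup, h.length, by rw [h2]; exact h.entry⟩

theorem Ordering.mem {q : List (Fin n)} {μ : ℕ → ℕ → ℕ} (h : Ordering q μ) (v : Fin n) : v ∈ q := by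
  have h1 : q.toFinset.card = n := by rw [List.toFinset_card_of_nodup h.nodup, h.length]
  have h2 : q.toFinset = Finset.univ := by
    rw [← Finset.card_eq_iff_eq_univ, h1, Fintype.card_fin]
  exact List.mem_toFinset.1 (h2 ▸ Finset.mem_univ v)

/-- With the array `2` fixed, the processed vertices form a prefix of `q`. A pass can thus exploit
the order of the search. -/
theorem runs_scan_queue (hB : Bounds adj M W) {body : Program} {s : State} (hs : Holds adj M s)
    {q : List (Fin n)} (hq : Ordering q s.mem)
    (I : List (Fin n) → (ℕ → ℕ → ℕ) → Prop)
    (J : List (Fin n) → Fin n → List (Fin n) → (ℕ → ℕ → ℕ) → Prop) (h0 : I [] s.mem)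
    (hbegin : ∀ ys y μ, ys ++ [y] <+: q → I ys μ → J ys y [] μ)
    (hstep : ∀ (ys : List (Fin n)) (y : Fin n) (xs : List (Fin n)) (x : Fin n),
      ys ++ [y] <+: q → xs ++ [x] <+: adj y → ∀ s', J ys y xs s'.mem → s'.reg 3 = (y : ℕ) →
      s'.reg 6 = (x : ℕ) →
      body.Fits W s' ∧ (body.exec s').reg = s'.reg ∧ (body.exec s').mem 0 = s'.mem 0 ∧
        (body.exec s').mem 1 = s'.mem 1 ∧ (body.exec s').mem 2 = s'.mem 2 ∧
        J ys y (xs ++ [x]) (body.exec s').mem)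
    (hend : ∀ ys y μ, ys ++ [y] <+: q → J ys y (adj y) μ → I (ys ++ [y]) μ) :
    Runs W (M * (2 * body.ticks + 51)) (scan body) s
      fun s' => Frame s s' ∧ s'.mem 2 = s.mem 2 ∧ I q s'.mem := by
  refine (runs_scan hB hs (fun ys μ => ys <+: q ∧ μ 2 = s.mem 2 ∧ I ys μ)
    (fun ys y xs μ => ys ++ [y] <+: q ∧ μ 2 = s.mem 2 ∧ J ys y xs μ)
    ⟨List.nil_prefix, rfl, h0⟩ ?_ ?_ ?_).mono le_rfl ?_
  · rintro ys μ ⟨hp, h2, hI⟩ hys hlt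
    obtain ⟨rest, hrest⟩ := hp
    cases rest with
    | nil =>
      have := hq.length
      rw [← hrest, List.append_nil] at this
      omega
    | cons y rest =>
      have hpre : ys ++ [y] <+: q := ⟨rest, by simpa using hrest⟩
      refine ⟨y, ?_, ?_, hpre, h2, hbegin _ _ _ hpre hI⟩
      · intro hmem
        have := hpre.sublist.nodup hq.nodup
        rw [List.nodup_append] at this
        exact this.2.2 _ hmem _ (by simp) rfl
      · have := hq.entry ys.length (by rw [← hrest]; simp)
        rw [h2, this]
        simp [← hrest]
  · rintro ys y xs x hx s' ⟨hp, h2, hJ⟩ h3 h6 hf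
    obtain ⟨g1, g2, g3, g4, g5, g6⟩ := hstep ys y xs x hp hx s' hJ h3 h6
    exact ⟨g1, g2, g3, g4, hp, g5.trans h2, g6⟩
  · rintro ys y μ ⟨hp, h2, hJ⟩
    exact ⟨hp, h2, hend ys y μ hp hJ⟩
  · rintro s' ⟨hf, ys, hys, hlen, hp, h2, hI⟩
    have : ys = q := hp.eq_of_length (by rw [hlen, hq.length])
    exact ⟨hf, h2, this ▸ hI⟩

/-- Stores for every vertex the sum of the entries of the array `b` at its neighbours. -/
def accumulate (a b : ℕ) : Program :=
  .seq (mapArray a (.const 0))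
    (scan (.store a (.reg 3) (.add (.load a (.reg 3)) (.load b (.reg 6)))))

/-- Lists have no repetitions, so `hsum` bounds every partial sum and no word overflows. -/
theorem runs_accumulate (hB : Bounds adj M W) (hadj : IsAdjacencyLists G adj) {a b : ℕ}
    (ha : 3 ≤ a) (hab : a ≠ b) {s : State} (hs : Holds adj M s) {q : List (Fin n)}
    (hq : Ordering q s.mem) (hsum : ∑ v : Fin n, s.mem b v ≤ n) :
    Runs W (100 * M) (accumulate a b) s fun s' => Frame s s' ∧ MemFrame [a] s.mem s'.mem ∧
      ∀ v : Fin n, s'.mem a v = ∑ x ∈ (adj v).toFinset, s.mem b x := by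
  have hn := hB.le
  have hw := hB.word
  have hpos := hB.pos
  have hbound : ∀ (xs : List (Fin n)), xs.Nodup → (xs.map fun x : Fin n => s.mem b x).sum ≤ n := by
    intro xs hxs
    rw [← List.sum_toFinset _ hxs]
    exact (Finset.sum_le_sum_of_subset (Finset.subset_univ _)).trans hsum
  have hsplit : 100 * M = 20 * M + 80 * M := by ring
  rw [hsplit]
  refine (runs_mapArray hB (by omega) hs (fun _ => 0)
    (fun v s' _ _ _ => ⟨Nat.zero_le _, rfl⟩) (by simp [Expr.cost])).seq ?_
  rintro s₁ ⟨hf₁, hm₁, h0⟩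
  have hb1 : s₁.mem b = s.mem b := hm₁ b (by simp [hab.symm])
  refine (runs_scan_queue hB (hs.of_frame hf₁) (hq.congr (hm₁ 2 (by simp; omega)))
    (fun ys μ => MemFrame [a] s.mem μ ∧ ∀ v : Fin n,
      (v ∈ ys → μ a v = ((adj v).map fun x : Fin n => s.mem b x).sum) ∧ (v ∉ ys → μ a v = 0))
    (fun ys y xs μ => MemFrame [a] s.mem μ ∧ (∀ v : Fin n, v ≠ y →
      (v ∈ ys → μ a v = ((adj v).map fun x : Fin n => s.mem b x).sum) ∧ (v ∉ ys → μ a v = 0)) ∧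
      μ a y = (xs.map fun x : Fin n => s.mem b x).sum) ?_ ?_ ?_ ?_).mono ?_ ?_
  · exact ⟨hm₁, fun v => ⟨fun h => by simp at h, fun _ => h0 v⟩⟩
  · rintro ys y μ hp ⟨hm, hv⟩
    have hy : y ∉ ys := fun hy => by
      have := hp.sublist.nodup hq.nodup
      rw [List.nodup_append] at this
      exact this.2.2 _ hy _ (by simp) rfl
    exact ⟨hm, fun v _ => hv v, by simpa using (hv y).2 hy⟩
  · rintro ys y xs x hp hx s' ⟨hm, hv, hy⟩ h3 h6
    have hmb : s'.mem b = s.mem b := hm b (by simp [hab.symm])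
    have hnd : (xs ++ [x]).Nodup := hx.sublist.nodup (hadj y).1
    have hle := hbound _ hnd
    rw [List.map_append, List.sum_append] at hle
    simp only [List.map_cons, List.map_nil, List.sum_cons, List.sum_nil, add_zero] at hle
    refine ⟨?_, rfl, ?_, ?_, ?_, ?_, ?_, ?_⟩
    · simp only [Program.Fits, Expr.Fits, Expr.eval, h3, h6, hy, hmb]
      omega
    · simp [Program.exec, (show (0 : ℕ) ≠ a by omega)]
    · simp [Program.exec, (show (1 : ℕ) ≠ a by omega)]
    · simp [Program.exec, (show (2 : ℕ) ≠ a by omega)]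
    · intro c hc
      rw [← hm c hc]
      simp only [List.mem_singleton] at hc
      simp [Program.exec, hc]
    · intro v hvy
      have hvy' : (v : ℕ) ≠ y := fun h => hvy (Fin.ext h)
      simp only [Program.exec, State.setMem_mem, Function.update_self, Expr.eval, h3,
        Function.update_of_ne hvy']
      exact hv v hvy
    · simp [Program.exec, Expr.eval, h3, h6, hy, hmb]
  · rintro ys y μ hp ⟨hm, hv, hy⟩
    refine ⟨hm, fun v => ?_⟩
    by_cases hvy : v = y
    · subst hvy
      simp [hy]
    · simpa [hvy] using hv v hvy
  · simp only [Program.ticks, Expr.cost]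
    omega
  · rintro s' ⟨hf, h2, hm, hv⟩
    refine ⟨hf₁.trans hf, hm, fun v => ?_⟩
    rw [(hv v).1 (hq.mem v), List.sum_toFinset _ (hadj v).1]

/-! ## A farthest vertex and the distances from it -/

/-- An expression that is `1` if `e` and `f` have the same value, and `0` otherwise. -/
def equalTest (e f : Expr) : Expr := .sub (.const 1) (.add (.sub e f) (.sub f e))

/-- Breadth-first search from the vertex in the register `r`. -/
def search (d r : ℕ) : Program := .seq (mapArray 11 (equalTest (.reg 1) (.reg r))) (bfs d)

/-- Finds a vertex farthest from the one in the register `10`, puts it into the register `11`, and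
computes the distances from both. -/
def twoSearches : Program :=
  .seq (search 3 10) (.seq (.assign 11 (.load 2 (.sub (.reg 0) (.const 1)))) (search 4 11))

theorem runs_search (hB : Bounds adj M W) (hadj : IsAdjacencyLists G adj)
    (hc : G.Connected) {d r : ℕ} (hd : 3 ≤ d ∧ d ≤ 5) (hr : 10 ≤ r) {s : State}
    (hs : Holds adj M s) (p : Fin n) (hp : s.reg r = p) :
    Runs W (300 * M) (search d r) s fun s' => Frame s s' ∧
      MemFrame [11, 2, d, 10] s.mem s'.mem ∧ ∃ q, Searched {p} (G.dist p) d q s'.mem := by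
  have hn := hB.le
  have hw := hB.word
  have hpos := hB.pos
  have hsplit : 300 * M = 100 * M + 200 * M := by ring
  rw [hsplit]
  refine (runs_mapArray hB (by omega) hs (fun v => if v = p then 1 else 0) ?_ (T := 100)
    (by simp [Expr.cost, equalTest])).seq ?_
  · intro v s' h1 hf hm
    have hr' : s'.reg r = p := (hf.reg r (Or.inr hr)).trans hp
    refine ⟨?_, ?_⟩
    · simp only [equalTest, Expr.Fits, Expr.eval, h1, hr']
      omega
    · simp only [equalTest, Expr.eval, h1, hr']
      by_cases hvp : v = p
      · simp [hvp]
      · have : (v : ℕ) ≠ p := fun h => hvp (Fin.ext h)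
        simp only [hvp, if_false]
        omega
  · rintro s₁ ⟨hf₁, hm₁, h11⟩
    refine (runs_bfs hB hadj (hc.isLevel_singleton p) hd (hs.of_frame hf₁) ?_).mono le_rfl ?_
    · intro v
      rw [h11 v]
      by_cases hvp : v = p <;> simp [hvp]
    · rintro s₂ ⟨hf₂, hm₂, hq⟩
      exact ⟨hf₁.trans hf₂, hm₁.trans hm₂, hq⟩

theorem Searched.far {lev : Fin n → ℕ} {d : ℕ} {K : Set (Fin n)} {q : List (Fin n)}
    {μ : ℕ → ℕ → ℕ} (h : Searched K lev d q μ) (hn : 0 < n) :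
    ∃ z : Fin n, μ 2 (n - 1) = z ∧ ∀ y, lev y ≤ lev z := by
  have hlt : n - 1 < q.length := by rw [h.length]; omega
  refine ⟨q[n - 1], h.entry _ hlt, fun y => ?_⟩
  obtain ⟨i, hi, rfl⟩ := List.mem_iff_getElem.1 (h.ordering.mem y)
  have hi' := hi
  rw [h.length] at hi'
  rcases Nat.lt_or_ge i (n - 1) with hlt' | hge
  · exact List.pairwise_iff_getElem.1 h.sorted i (n - 1) hi hlt hlt'
  · have : i = n - 1 := by omega
    subst this
    exact le_rfl

theorem Holds.setReg {s : State} (hs : Holds adj M s) {r : ℕ} (hr : r ≠ 0) (v : ℕ) :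
    Holds adj M (s.setReg r v) :=
  ⟨by simpa [hr.symm] using hs.reg, hs.offset_succ, hs.offset_le, hs.entry⟩

/-- The outcome of the two searches. -/
structure Swept (G : SimpleGraph (Fin n)) (p z : Fin n) (s : State) : Prop where
  reg : s.reg 11 = z
  far : ∀ y, G.dist p y ≤ G.dist p z
  dist_left : ∀ v : Fin n, s.mem 3 v = G.dist p v + 1
  dist_right : ∀ v : Fin n, s.mem 4 v = G.dist z v + 1
  last : ∃ w : Fin n, s.mem 2 (n - 1) = w ∧ ∀ y, G.dist z y ≤ G.dist z w

/-- Levels increase along a search queue, so its last entry is farthest from the source. The queue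
of the second search remains and gives the eccentricity of `z`. -/
theorem runs_twoSearches (hB : Bounds adj M W) (hadj : IsAdjacencyLists G adj)
    (hc : G.Connected) {s : State} (hs : Holds adj M s) (p : Fin n) (hp : s.reg 10 = p) :
    Runs W (605 * M) twoSearches s fun s' => Holds adj M s' ∧
      (∀ r, 10 ≤ r → r ≠ 11 → s'.reg r = s.reg r) ∧ ∃ z : Fin n, Swept G p z s' := by
  have hn := hB.le
  have hw := hB.word
  have hpos := hB.pos
  have hn0 : 0 < n := p.pos
  have hsplit : 605 * M = 300 * M + (5 * M + 300 * M) := by ring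
  rw [hsplit]
  refine (runs_search hB hadj hc (by omega) le_rfl hs p hp).seq ?_
  rintro s₁ ⟨hf₁, hm₁, q, hq⟩
  obtain ⟨z, hz, hfar⟩ := hq.far hn0
  have hs₁ := hs.of_frame hf₁
  have h0 := hs₁.reg
  have hzn := z.2
  refine ((Program.runs_exec (W := W) (.assign 11 (.load 2 (.sub (.reg 0) (.const 1)))) s₁ ?_).mono
    (T' := 5 * M) ?_ fun _ h => h).seq ?_
  · simp only [Program.Fits, Expr.Fits, Expr.eval, h0, hz]
    omega
  · simp [Program.ticks, Expr.cost]
    omega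
  rintro _ rfl
  simp only [Program.exec, Expr.eval, h0, hz]
  refine (runs_search hB hadj hc (d := 4) (r := 11) (by omega) (by omega)
    (hs₁.setReg (r := 11) (by omega) z) z (by simp)).mono le_rfl ?_
  rintro s' ⟨hf₂, hm₂, q', hq'⟩
  refine ⟨(hs₁.setReg (r := 11) (by omega) z).of_frame hf₂, ?_, z, ?_, hfar, ?_, hq'.levels,
    hq'.far hn0⟩
  · intro r hr hr'
    rw [hf₂.reg r (Or.inr hr), State.setReg_reg, Function.update_of_ne hr', hf₁.reg r (Or.inr hr)]
  · rw [hf₂.reg 11 (by omega)]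
    simp
  · intro v
    rw [hm₂ 3 (by simp)]
    exact hq.levels v

end RAM

namespace RAM

variable {n : ℕ} {adj : Fin n → List (Fin n)} {M W : ℕ} {G : SimpleGraph (Fin n)}
  {K : Set (Fin n)} {lev : Fin n → ℕ} {q : List (Fin n)}

/-! ## Computing gates -/

/-- Computes gates in the array `7`, from the levels in the array `5`. The array `6` receives the
numbers of the nearest vertices of the source. -/
def gatePass : Program :=
  scan (.ifNonzero (.sub (.load 5 (.reg 6)) (.load 5 (.reg 3)))
    (.ifNonzero (.sub (.load 5 (.reg 3)) (.const 1))
      (.ifNonzero (.sub (.load 6 (.reg 3)) (.load 6 (.reg 6)))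
        (.seq (.store 6 (.reg 6) (.load 6 (.reg 3))) (.store 7 (.reg 6) (.load 7 (.reg 3))))
        .skip) .skip) .skip)

/-- The invariant of the computation of the gates: the edges in `P` have been processed. -/
structure GateInv (G : SimpleGraph (Fin n)) (K : Set (Fin n)) (lev : Fin n → ℕ)
    (P : Fin n → Fin n → Prop) (μ : ℕ → ℕ → ℕ) : Prop where
  le : ∀ v : Fin n, μ 6 v ≤ n
  gate_lt : ∀ v : Fin n, μ 7 v < n
  one : ∀ v : Fin n, lev v = 1 → μ 6 v = G.projCard K lev v ∧ μ 7 v = v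
  ge : ∀ x y : Fin n, 2 ≤ lev x → G.Adj x y → lev y + 1 = lev x → P y x →
    G.projCard K lev y ≤ μ 6 x
  witness : ∀ x : Fin n, 2 ≤ lev x → μ 6 x ≠ 0 → ∃ y, G.Adj x y ∧ lev y + 1 = lev x ∧
    ∃ g : Fin n, μ 7 x = g ∧ G.IsGate K lev g y ∧ μ 6 x = G.projCard K lev y

/-- Some inner neighbour has the whole projection of `x`, and none has more. Once all inner edges
are processed, the recorded maximum is therefore attained by a neighbour with the same projection,
whose gate serves `x`. -/
theorem GateInv.isGate {P : Fin n → Fin n → Prop} {μ : ℕ → ℕ → ℕ} (h : GateInv G K lev P μ)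
    (hG : G.IsAlphaOneDeltaMetric) (hl : G.IsLevel K lev)
    (hK : ∀ u ∈ K, ∀ v ∈ K, u ≠ v → G.Adj u v) {x : Fin n} (hx : lev x ≠ 0)
    (hP : ∀ y, G.Adj x y → lev y + 1 = lev x → P y x) :
    ∃ g : Fin n, μ 7 x = g ∧ G.IsGate K lev g x ∧ μ 6 x = G.projCard K lev x := by
  rcases Nat.lt_or_ge (lev x) 2 with h1 | h2
  · have h1' : lev x = 1 := by omega
    exact ⟨x, (h.one x h1').2, SimpleGraph.IsLevel.isGate_self h1', (h.one x h1').1⟩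
  · obtain ⟨y, hxy, hy, hcard⟩ :=
      hl.exists_projCard_le hG hK (x := x) (l := lev x - 2) (by omega)
    have h3 := h.ge x y h2 hxy (by omega) (hP y hxy (by omega))
    have h4 := hl.projCard_pos hG.connected x
    obtain ⟨y', hxy', hy', g, hg, hgate, hw⟩ := h.witness x h2 (by omega)
    refine ⟨g, hg, hl.isGate_of_projCard_le hG.connected hxy' hy' hgate (by omega), ?_⟩
    have h5 : G.projCard K lev y' ≤ G.projCard K lev x :=
      Set.ncard_le_ncard (hl.proj_subset hG.connected hxy' hy') (Set.toFinite _)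
    omega

theorem runs_gatePass (hB : Bounds adj M W) (hadj : IsAdjacencyLists G adj)
    (hG : G.IsAlphaOneDeltaMetric) (hl : G.IsLevel K lev)
    (hK : ∀ u ∈ K, ∀ v ∈ K, u ≠ v → G.Adj u v) {s : State} (hs : Holds adj M s)
    (hq : Searched K lev 5 q s.mem) (h7 : ∀ v : Fin n, s.mem 7 v = v)
    (h6 : ∀ v : Fin n, s.mem 6 v ≤ n)
    (h61 : ∀ v : Fin n, lev v = 1 → s.mem 6 v = G.projCard K lev v)
    (h62 : ∀ v : Fin n, 2 ≤ lev v → s.mem 6 v = 0) :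
    Runs W (200 * M) gatePass s fun s' => Frame s s' ∧ MemFrame [6, 7] s.mem s'.mem ∧
      ∃ gate : Fin n → Fin n, (∀ v : Fin n, s'.mem 7 v = gate v) ∧
        ∀ y, lev y ≠ 0 → G.IsGate K lev (gate y) y := by
  have hn := hB.le
  have hw := hB.word
  have hpos := hB.pos
  refine (runs_scan_queue hB hs hq.ordering
    (fun ys μ => MemFrame [6, 7] s.mem μ ∧ GateInv G K lev (fun y _ => y ∈ ys) μ)
    (fun ys y xs μ => MemFrame [6, 7] s.mem μ ∧
      GateInv G K lev (fun y' x => y' ∈ ys ∨ (y' = y ∧ x ∈ xs)) μ) ?_ ?_ ?_ ?_).mono ?_ ?_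
  · refine ⟨fun _ _ => rfl, h6, fun v => ?_, fun v hv => ⟨h61 v hv, h7 v⟩, ?_, ?_⟩
    · rw [h7 v]
      exact v.2
    · intro x y _ _ _ h
      simp at h
    · intro x hx hne
      exact absurd (h62 x hx) hne
  · rintro ys y μ hp ⟨hm, h⟩
    refine ⟨hm, h.le, h.gate_lt, h.one, ?_, h.witness⟩
    intro x z hx hxz hz hP
    exact h.ge x z hx hxz hz (by simpa using hP)
  · rintro ys y xs x hp hx s' ⟨hm, h⟩ r3 r6
    have hyx : G.Adj y x := (hadj y).2 x |>.1 (hx.subset (by simp))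
    have hlx : s'.mem 5 x = lev x + 1 := by
      rw [hm 5 (by simp)]
      exact hq.levels x
    have hly : s'.mem 5 y = lev y + 1 := by
      rw [hm 5 (by simp)]
      exact hq.levels y
    have hxn := hl.lt_card x
    have hyn := hl.lt_card y
    have h6x := h.le x
    have h6y := h.le y
    have h7y := h.gate_lt y
    have hle := hl.le_add_one y x hyx
    -- The queue is sorted by level, so all inner neighbours of `y` precede it and the entries of
    -- `y` are final when it hands them on.
    have hfin : lev y ≠ 0 →
        ∃ g : Fin n, s'.mem 7 y = g ∧ G.IsGate K lev g y ∧ s'.mem 6 y = G.projCard K lev y := by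
      intro hy0
      refine h.isGate hG hl hK hy0 fun z hyz hz => Or.inl ?_
      obtain ⟨rest, hrest⟩ := hp
      have hzq := hq.ordering.mem z
      have hsort := hq.sorted
      rw [← hrest, List.append_assoc] at hzq hsort
      rcases List.mem_append.1 hzq with hz' | hz'
      · exact hz'
      · have hsort' := (List.pairwise_append.1 hsort).2.1
        rw [List.singleton_append] at hz' hsort'
        rcases List.mem_cons.1 hz' with rfl | hz'
        · omega
        · have := (List.pairwise_cons.1 hsort').1 z hz'
          omega
    by_cases hcond : lev y < lev x ∧ lev y ≠ 0 ∧ s'.mem 6 x < s'.mem 6 y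
    · obtain ⟨c1, c2, c3⟩ := hcond
      obtain ⟨g, hg, hgate, hw6⟩ := hfin c2
      have e1 : lev x + 1 - (lev y + 1) ≠ 0 := by omega
      have e2 : lev y + 1 - 1 ≠ 0 := by omega
      have e3 : s'.mem 6 y - s'.mem 6 x ≠ 0 := by omega
      have hexec : Program.exec (.ifNonzero (.sub (.load 5 (.reg 6)) (.load 5 (.reg 3)))
          (.ifNonzero (.sub (.load 5 (.reg 3)) (.const 1))
            (.ifNonzero (.sub (.load 6 (.reg 3)) (.load 6 (.reg 6)))
              (.seq (.store 6 (.reg 6) (.load 6 (.reg 3)))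
                (.store 7 (.reg 6) (.load 7 (.reg 3))))
              .skip) .skip) .skip) s' =
          (s'.setMem 6 x (s'.mem 6 y)).setMem 7 x (s'.mem 7 y) := by
        simp only [Program.exec, Expr.eval, r3, r6, hlx, hly, if_pos e1, if_pos e2, if_pos e3,
          State.setMem_reg]
        rfl
      rw [hexec]
      have hxv : ∀ {v : Fin n}, v ≠ x → (v : ℕ) ≠ x := fun hv h => hv (Fin.ext h)
      refine ⟨?_, rfl, rfl, rfl, rfl, ?_, ?_, ?_, ?_, ?_, ?_⟩
      · simp only [Program.Fits, Expr.Fits, Expr.eval, Program.exec, r3, r6, hlx, hly,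
          State.setMem_reg, State.setMem_mem, ne_eq]
        rw [Function.update_of_ne (by omega)]
        omega
      · intro a ha
        rw [← hm a ha]
        simp only [List.mem_cons, List.not_mem_nil, or_false, not_or] at ha
        simp [ha.1, ha.2]
      · intro v
        by_cases hv : v = x
        · simp [hv, h6y]
        · simpa [hxv hv] using h.le v
      · intro v
        by_cases hv : v = x
        · simp [hv, h7y]
        · simpa [hxv hv] using h.gate_lt v
      · intro v hv1
        have hv : v ≠ x := by rintro rfl; omega
        simpa [hxv hv] using h.one v hv1
      · intro v z hv2 hvz hz hP
        by_cases hv : v = x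
        · subst hv
          simp only [State.setMem_mem, Function.update_self, Function.update_of_ne
            (show (6 : ℕ) ≠ 7 by omega)]
          rcases hP with hP | ⟨rfl, hP⟩
          · have := h.ge v z hv2 hvz hz (Or.inl hP)
            omega
          · omega
        · have := h.ge v z hv2 hvz hz (by simpa [hv] using hP)
          simpa [hxv hv] using this
      · intro v hv2 hne
        by_cases hv : v = x
        · subst hv
          exact ⟨y, hyx.symm, by omega, g, by simpa using hg, hgate, by simpa using hw6⟩
        · simpa [hxv hv] using h.witness v hv2 (by simpa [hxv hv] using hne)
    · have hexec : Program.exec (.ifNonzero (.sub (.load 5 (.reg 6)) (.load 5 (.reg 3)))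
          (.ifNonzero (.sub (.load 5 (.reg 3)) (.const 1))
            (.ifNonzero (.sub (.load 6 (.reg 3)) (.load 6 (.reg 6)))
              (.seq (.store 6 (.reg 6) (.load 6 (.reg 3)))
                (.store 7 (.reg 6) (.load 7 (.reg 3))))
              .skip) .skip) .skip) s' = s' := by
        simp only [Program.exec, Expr.eval, r3, r6, hlx, hly]
        split_ifs with e1 e2 e3
        · exact absurd ⟨by omega, by omega, by omega⟩ hcond
        all_goals rfl
      rw [hexec]
      refine ⟨?_, rfl, rfl, rfl, rfl, hm, h.le, h.gate_lt, h.one, ?_, h.witness⟩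
      · simp only [Program.Fits, Expr.Fits, Expr.eval, r3, r6, hlx, hly, Program.exec,
          State.setMem_reg, State.setMem_mem, ne_eq, implies_true, and_true]
        refine ⟨by omega, fun e1 => ⟨by omega, fun e2 => ⟨by omega, fun e3 => ?_⟩⟩⟩
        exact absurd ⟨by omega, by omega, by omega⟩ hcond
      · intro v z hv2 hvz hz hP
        by_cases hold : z ∈ ys ∨ (z = y ∧ v ∈ xs)
        · exact h.ge v z hv2 hvz hz hold
        · have hzv : z = y ∧ v = x := by
            simp only [List.mem_append, List.mem_singleton] at hP
            tauto
          obtain ⟨rfl, rfl⟩ := hzv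
          obtain ⟨g, hg, hgate, hw6⟩ := hfin (by omega)
          rw [← hw6]
          by_contra! hlt
          exact hcond ⟨by omega, by omega, hlt⟩
  · rintro ys y μ hp ⟨hm, h⟩
    refine ⟨hm, h.le, h.gate_lt, h.one, ?_, h.witness⟩
    intro x z hx hxz hz hP
    refine h.ge x z hx hxz hz ?_
    rcases List.mem_append.1 hP with hP | hP
    · exact Or.inl hP
    · have := List.mem_singleton.1 hP
      subst this
      exact Or.inr ⟨rfl, ((hadj z).2 x).2 hxz.symm⟩
  · simp only [Program.ticks, Expr.cost]
    omega
  · rintro s' ⟨hf, h2, hm, h⟩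
    refine ⟨hf, hm, fun v => ⟨s'.mem 7 v, h.gate_lt v⟩, fun v => rfl, fun y hy => ?_⟩
    obtain ⟨g, hg, hgate, -⟩ := h.isGate hG hl hK hy fun z _ _ => hq.ordering.mem z
    have : g = ⟨s'.mem 7 y, h.gate_lt y⟩ := Fin.ext hg.symm
    rw [this] at hgate
    exact hgate

/-! ## Counting the vertices with a given gate -/

/-- Counts in the array `8`, for every vertex `x`, the vertices with gate `x` whose entry in the
array `5` is the register `12`. -/
def hitsPass : Program :=
  .seq (mapArray 8 (.const 0))
    (forVertices (.ifNonzero (equalTest (.load 5 (.reg 1)) (.reg 12))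
      (.store 8 (.load 7 (.reg 1)) (.add (.load 8 (.load 7 (.reg 1))) (.const 1))) .skip))

theorem runs_hitsPass (hB : Bounds adj M W) {s : State} (hs : Holds adj M s)
    (hlev : ∀ v : Fin n, s.mem 5 v = lev v + 1) (hlt : ∀ v, lev v < n) {gate : Fin n → Fin n}
    (h7 : ∀ v : Fin n, s.mem 7 v = gate v) {r : ℕ} (hr : s.reg 12 = r + 1) (hrn : r < n) :
    Runs W (200 * M) hitsPass s fun s' => Frame s s' ∧ MemFrame [8] s.mem s'.mem ∧
      ∀ x : Fin n, s'.mem 8 x = (Finset.univ.filter fun y => lev y = r ∧ gate y = x).card := by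
  have hn := hB.le
  have hw := hB.word
  have hpos := hB.pos
  have hsplit : 200 * M = 20 * M + 180 * M := by ring
  rw [hsplit]
  refine (runs_mapArray hB (by omega) hs (fun _ => 0)
    (fun v s' _ _ _ => ⟨Nat.zero_le _, rfl⟩) (by simp [Expr.cost])).seq ?_
  rintro s₁ ⟨hf₁, hm₁, h0⟩
  refine (runs_forVertices hB (hs.of_frame hf₁) (fun i μ => MemFrame [8] s.mem μ ∧
    ∀ x : Fin n, μ 8 x =
      (Finset.univ.filter fun y : Fin n => (y : ℕ) < i ∧ lev y = r ∧ gate y = x).card)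
    ⟨hm₁, fun x => by simp [h0 x]⟩ ?_).mono ?_ ?_
  · rintro i hi s' ⟨hm, h8⟩ h1 hf
    -- The array `5` also stores levels increased by one, so plain equality selects level `r`.
    have r12 : s'.reg 12 = r + 1 := by
      rw [hf.reg 12 (by omega), hf₁.reg 12 (by omega), hr]
    set v : Fin n := ⟨i, hi⟩ with hv
    have hvi : (v : ℕ) = i := rfl
    have l5 : s'.mem 5 i = lev v + 1 := by
      rw [hm 5 (by simp)]
      exact hlev v
    have l7 : s'.mem 7 i = gate v := by
      rw [hm 7 (by simp)]
      exact h7 v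
    have hlv := hlt v
    have hgv := (gate v).2
    have h8' := h8 (gate v)
    have hcard : s'.mem 8 (gate v) ≤ n := by
      rw [h8']
      exact (Finset.card_le_univ _).trans_eq (Fintype.card_fin n)
    by_cases hc : lev v = r
    · have e1 : 1 - (lev v + 1 - (r + 1) + (r + 1 - (lev v + 1))) ≠ 0 := by omega
      have hexec : Program.exec (.ifNonzero (equalTest (.load 5 (.reg 1)) (.reg 12))
          (.store 8 (.load 7 (.reg 1)) (.add (.load 8 (.load 7 (.reg 1))) (.const 1))) .skip) s' =
          s'.setMem 8 (gate v) (s'.mem 8 (gate v) + 1) := by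
        simp only [equalTest, Program.exec, Expr.eval, h1, l5, l7, r12, if_pos e1]
      rw [hexec]
      refine ⟨?_, rfl, rfl, rfl, ?_, ?_⟩
      · simp only [equalTest, Program.Fits, Expr.Fits, Expr.eval, h1, l5, l7, r12, ne_eq]
        omega
      · intro a ha
        rw [← hm a ha]
        simp only [List.mem_singleton] at ha
        simp [ha]
      · intro x
        by_cases hx : gate v = x
        · subst hx
          simp only [State.setMem_mem, Function.update_self]
          rw [h8', ← Finset.card_insert_of_notMem (a := v) (by simp [hv])]
          congr 1
          ext y
          simp only [Finset.mem_insert, Finset.mem_filter, Finset.mem_univ, true_and]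
          constructor
          · rintro (rfl | ⟨g1, g2⟩)
            · exact ⟨by omega, hc, rfl⟩
            · exact ⟨by omega, g2⟩
          · rintro ⟨g1, g2⟩
            rcases Nat.lt_succ_iff_lt_or_eq.1 g1 with g | g
            · exact Or.inr ⟨g, g2⟩
            · exact Or.inl (Fin.ext g)
        · have hx' : (x : ℕ) ≠ gate v := fun h => hx (Fin.ext h).symm
          simp only [State.setMem_mem, Function.update_self, Function.update_of_ne hx']
          rw [h8 x]
          congr 1
          ext y
          simp only [Finset.mem_filter, Finset.mem_univ, true_and]
          constructor
          · rintro ⟨g1, g2⟩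
            exact ⟨by omega, g2⟩
          · rintro ⟨g1, g2, g3⟩
            rcases Nat.lt_succ_iff_lt_or_eq.1 g1 with g | g
            · exact ⟨g, g2, g3⟩
            · exact absurd ((Fin.ext g : y = v) ▸ g3) hx
    · have e1 : ¬ (1 - (lev v + 1 - (r + 1) + (r + 1 - (lev v + 1))) ≠ 0) := by omega
      have hexec : Program.exec (.ifNonzero (equalTest (.load 5 (.reg 1)) (.reg 12))
          (.store 8 (.load 7 (.reg 1)) (.add (.load 8 (.load 7 (.reg 1))) (.const 1))) .skip) s' =
          s' := by
        simp only [equalTest, Program.exec, Expr.eval, h1, l5, r12, if_neg e1]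
      rw [hexec]
      refine ⟨?_, rfl, rfl, rfl, hm, ?_⟩
      · simp only [equalTest, Program.Fits, Expr.Fits, Expr.eval, h1, l5, l7, r12]
        exact ⟨by omega, fun h => absurd h e1, fun _ => trivial⟩
      · intro x
        rw [h8 x]
        congr 1
        ext y
        simp only [Finset.mem_filter, Finset.mem_univ, true_and]
        constructor
        · rintro ⟨g1, g2⟩
          exact ⟨by omega, g2⟩
        · rintro ⟨g1, g2, g3⟩
          rcases Nat.lt_succ_iff_lt_or_eq.1 g1 with g | g
          · exact ⟨g, g2, g3⟩
          · exact absurd ((Fin.ext g : y = v) ▸ g2) hc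
  · simp only [equalTest, Program.ticks, Expr.cost]
    omega
  · rintro s' ⟨hf, hm, h8⟩
    refine ⟨hf₁.trans hf, hm, fun x => ?_⟩
    rw [h8 x]
    simp

/-! ## Selecting a marked vertex with the largest entry -/

/-- Finds a vertex marked in the array `11` with the largest entry in the array `9`, and stores it
in the cell `1` of the array `12`. -/
def bestPass : Program :=
  .seq (.store 12 (.const 0) (.const 0))
    (forVertices (.ifNonzero (.load 11 (.reg 1))
      (.ifNonzero (.sub (.add (.load 9 (.reg 1)) (.const 1)) (.load 12 (.const 0)))
        (.seq (.store 12 (.const 0) (.load 9 (.reg 1))) (.store 12 (.const 1) (.reg 1)))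
        .skip) .skip))

theorem runs_bestPass (hB : Bounds adj M W) {s : State} (hs : Holds adj M s)
    (hK : Marks K (s.mem 11)) (hne : K.Nonempty) (h9 : ∀ v : Fin n, s.mem 9 v ≤ n) :
    Runs W (200 * M) bestPass s fun s' => Frame s s' ∧ ∃ b ∈ K, s'.mem 12 1 = (b : Fin n) ∧
      ∀ v ∈ K, s.mem 9 v ≤ s.mem 9 b := by
  have hn := hB.le
  have hw := hB.word
  have hpos := hB.pos
  have hsplit : 200 * M = 3 * M + 197 * M := by ring
  rw [hsplit]
  refine ((Program.runs_exec (W := W) (.store 12 (.const 0) (.const 0)) s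
    (by simp [Program.Fits, Expr.Fits])).mono (by simp [Program.ticks, Expr.cost]; omega)
    fun _ h => h).seq ?_
  rintro _ rfl
  set s₁ := Program.exec (.store 12 (.const 0) (.const 0)) s with hs₁
  have hf₁ : Frame s s₁ := ⟨fun _ _ => rfl, rfl, rfl⟩
  refine (runs_forVertices hB (hs.of_frame hf₁) (fun i μ => MemFrame [12] s.mem μ ∧
    ((μ 12 0 = 0 ∧ ∀ v ∈ K, i ≤ (v : ℕ)) ∨ ∃ b ∈ K, μ 12 0 = s.mem 9 b ∧ μ 12 1 = (b : Fin n) ∧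
      ∀ v ∈ K, (v : ℕ) < i → s.mem 9 v ≤ s.mem 9 b)) ⟨?_, Or.inl ⟨?_, by simp⟩⟩ ?_).mono ?_ ?_
  · intro a ha
    simp only [List.mem_singleton] at ha
    simp [s₁, Program.exec, ha]
  · simp [s₁, Program.exec, Expr.eval]
  · rintro i hi s' ⟨hm, hinv⟩ h1 hf
    set v : Fin n := ⟨i, hi⟩ with hv
    have l9 : s'.mem 9 i = s.mem 9 i := by rw [hm 9 (by simp)]
    have l11 : s'.mem 11 i = s.mem 11 i := by rw [hm 11 (by simp)]
    have h9v : s.mem 9 i ≤ n := h9 v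
    have h12 : s'.mem 12 0 ≤ n := by
      rcases hinv with ⟨g, -⟩ | ⟨b, -, g, -⟩
      · omega
      · rw [g]
        exact h9 b
    have hstep : ∀ w ∈ K, (w : ℕ) < i + 1 → v ∉ K → (w : ℕ) < i := by
      intro w hw hwi hvK
      rcases Nat.lt_succ_iff_lt_or_eq.1 hwi with g | g
      · exact g
      · exact absurd ((Fin.ext g : w = v) ▸ hw) hvK
    by_cases hvK : v ∈ K
    · have e1 : s.mem 11 i = 1 := (hK v).1 hvK
      -- The comparison is not strict, so the first marked vertex beats the initial value 0 even if
      -- its own entry is 0.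
      by_cases hc : s'.mem 12 0 ≤ s.mem 9 i
      · have e2 : s.mem 9 i + 1 - s'.mem 12 0 ≠ 0 := by omega
        have hexec : Program.exec (.ifNonzero (.load 11 (.reg 1))
            (.ifNonzero (.sub (.add (.load 9 (.reg 1)) (.const 1)) (.load 12 (.const 0)))
              (.seq (.store 12 (.const 0) (.load 9 (.reg 1))) (.store 12 (.const 1) (.reg 1)))
              .skip) .skip) s' = (s'.setMem 12 0 (s.mem 9 i)).setMem 12 1 i := by
          simp only [Program.exec, Expr.eval, h1, l9, l11, e1, if_pos e2, ne_eq, one_ne_zero,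
            not_false_eq_true, if_true, State.setMem_reg]
        rw [hexec]
        refine ⟨?_, rfl, rfl, rfl, ?_, Or.inr ⟨v, hvK, ?_, ?_, ?_⟩⟩
        · simp only [Program.Fits, Program.exec, Expr.Fits, Expr.eval, h1, l9, l11, e1,
            State.setMem_reg]
          refine ⟨by omega, fun _ => ⟨by omega, fun _ => ?_, fun _ => trivial⟩, by omega⟩
          omega
        · intro a ha
          rw [← hm a ha]
          simp only [List.mem_singleton] at ha
          simp [ha]
        · simp [hv]
        · simp [hv]
        · intro w hw hwi
          rcases Nat.lt_succ_iff_lt_or_eq.1 hwi with g | g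
          · rcases hinv with ⟨-, g'⟩ | ⟨b, -, g1, -, g2⟩
            · have := g' w hw
              omega
            · have := g2 w hw g
              exact this.trans (g1 ▸ hc)
          · exact le_of_eq (by rw [g])
      · have e2 : ¬ (s.mem 9 i + 1 - s'.mem 12 0 ≠ 0) := by omega
        have hexec : Program.exec (.ifNonzero (.load 11 (.reg 1))
            (.ifNonzero (.sub (.add (.load 9 (.reg 1)) (.const 1)) (.load 12 (.const 0)))
              (.seq (.store 12 (.const 0) (.load 9 (.reg 1))) (.store 12 (.const 1) (.reg 1)))
              .skip) .skip) s' = s' := by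
          simp only [Program.exec, Expr.eval, h1, l9, l11, e1, if_neg e2, ne_eq, one_ne_zero,
            not_false_eq_true, if_true]
        rw [hexec]
        refine ⟨?_, rfl, rfl, rfl, hm, Or.inr ?_⟩
        · simp only [Program.Fits, Program.exec, Expr.Fits, Expr.eval, h1, l9, l11, e1,
            State.setMem_reg]
          exact ⟨by omega, fun _ => ⟨by omega, fun h => absurd h e2, fun _ => trivial⟩, by omega⟩
        · rcases hinv with ⟨g', -⟩ | ⟨b, hb, g1, g3, g2⟩
          · omega
          · refine ⟨b, hb, g1, g3, fun w hw hwi => ?_⟩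
            rcases Nat.lt_succ_iff_lt_or_eq.1 hwi with g | g
            · exact g2 w hw g
            · rw [g]
              omega
    · have e1 : s.mem 11 i = 0 := (hK v).2 hvK
      have hexec : Program.exec (.ifNonzero (.load 11 (.reg 1))
          (.ifNonzero (.sub (.add (.load 9 (.reg 1)) (.const 1)) (.load 12 (.const 0)))
            (.seq (.store 12 (.const 0) (.load 9 (.reg 1))) (.store 12 (.const 1) (.reg 1)))
            .skip) .skip) s' = s' := by
        simp [Program.exec, Expr.eval, h1, l11, e1]
      rw [hexec]
      refine ⟨?_, rfl, rfl, rfl, hm, ?_⟩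
      · simp only [Program.Fits, Expr.Fits, Expr.eval, h1, l11, e1]
        exact ⟨by omega, fun h => absurd rfl h, fun _ => trivial⟩
      · rcases hinv with ⟨g', g⟩ | ⟨b, hb, g1, g3, g2⟩
        · refine Or.inl ⟨g', fun w hw => ?_⟩
          have := g w hw
          by_contra! hlt
          have := hstep w hw hlt hvK
          omega
        · exact Or.inr ⟨b, hb, g1, g3, fun w hw hwi => g2 w hw (hstep w hw hwi hvK)⟩
  · simp only [Program.ticks, Expr.cost]
    omega
  · rintro s' ⟨hf, hm, hinv⟩
    refine ⟨hf₁.trans hf, ?_⟩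
    rcases hinv with ⟨-, g⟩ | ⟨b, hb, -, g3, g2⟩
    · obtain ⟨v, hv⟩ := hne
      have := g v hv
      omega
    · exact ⟨b, hb, g3, fun v hv => g2 v hv v.2⟩

end RAM

/-! ### Selecting a neighbour and performing one step of the descent. -/

namespace RAM

variable {n : ℕ} {adj : Fin n → List (Fin n)} {M W : ℕ} {G : SimpleGraph (Fin n)}
  {K : Set (Fin n)} {lev : Fin n → ℕ} {q : List (Fin n)}

theorem Marks.sum_eq {f : ℕ → ℕ} (h : Marks K f) (S : Finset (Fin n)) :
    ∑ x ∈ S, f x = {u | u ∈ S ∧ u ∈ K}.ncard := by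
  classical
  have h1 : ∀ x ∈ S, f x = if x ∈ K then 1 else 0 := fun x _ => by
    split_ifs with hx
    · exact (h x).1 hx
    · exact (h x).2 hx
  rw [Finset.sum_congr rfl h1, ← Finset.card_filter, ← Set.ncard_coe_finset]
  congr 1
  ext x
  simp

theorem Searched.congr {d : ℕ} {μ μ' : ℕ → ℕ → ℕ} (h : Searched K lev d q μ) (h2 : μ' 2 = μ 2)
    (hd : μ' d = μ d) : Searched K lev d q μ' :=
  ⟨h.nodup, h.length, h.sorted, by rw [h2]; exact h.entry, by rw [hd]; exact h.levels⟩

/-- Is the vertex in the register `1` a neighbour of the one in the register `10` on the way to the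
vertex from which the distances in the array `4` are measured? -/
def towardsTest : Expr :=
  .sub (.const 1) (.add (.add (.sub (.load 3 (.reg 1)) (.const 2))
    (.sub (.const 2) (.load 3 (.reg 1))))
      (.sub (.add (.load 4 (.reg 1)) (.const 1)) (.load 4 (.reg 10))))

/-- Selects a vertex among the marked vertices, from the distances to the set of these. -/
def select : Program :=
  .seq (bfs 5) (.seq (accumulate 6 11) (.seq (mapArray 7 (.reg 1)) (.seq gatePass
    (.seq hitsPass (.seq (accumulate 9 8) bestPass)))))

/-- One step of the descent, from the vertex in the register `10` to the one in the register `13`.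
The register `12` receives the eccentricity of the former. -/
def descend : Program :=
  .seq twoSearches (.seq (.assign 12 (.sub (.load 3 (.reg 11)) (.const 1)))
    (.seq (mapArray 11 towardsTest) (.seq select (.assign 13 (.load 12 (.const 1))))))

/-- Counting by fibres of `gate`. With `S` the neighbourhood of `u`, summing the gate counts over
one adjacency list gives the number that decides the comparison of the candidates. -/
theorem sum_card_filter_gate (r : ℕ) (gate : Fin n → Fin n) (S : Finset (Fin n)) :
    ∑ x ∈ S, (Finset.univ.filter fun y => lev y = r ∧ gate y = x).card =
      {y | lev y = r ∧ gate y ∈ S}.ncard := by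
  classical
  have h := Finset.card_eq_sum_card_fiberwise (f := gate)
    (s := Finset.univ.filter fun y => lev y = r ∧ gate y ∈ S) (t := S) (fun y hy => by
      simp only [Finset.coe_filter, Finset.mem_univ, true_and, Set.mem_ofPred_eq] at hy
      exact hy.2)
  rw [← Set.ncard_coe_finset] at h
  simp only [Finset.coe_filter, Finset.mem_univ, true_and] at h
  rw [h]
  refine Finset.sum_congr rfl fun x hx => ?_
  rw [Finset.filter_filter]
  congr 1
  ext y
  simp only [Finset.mem_filter, Finset.mem_univ, true_and]
  constructor
  · rintro ⟨g1, rfl⟩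
    exact ⟨⟨g1, hx⟩, rfl⟩
  · rintro ⟨⟨g1, -⟩, g2⟩
    exact ⟨g1, g2⟩

theorem ncard_le_card (S : Set (Fin n)) : S.ncard ≤ n := by
  simpa using Set.ncard_le_ncard (Set.subset_univ S) (Set.toFinite _)

theorem runs_select (hB : Bounds adj M W) (hadj : IsAdjacencyLists G adj)
    (hG : G.IsAlphaOneDeltaMetric) (hK : ∀ u ∈ K, ∀ v ∈ K, u ≠ v → G.Adj u v)
    (hne : K.Nonempty) {s : State} (hs : Holds adj M s) (hmark : Marks K (s.mem 11)) {r : ℕ}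
    (hr : s.reg 12 = r + 1) (hrn : r < n) :
    Runs W (1200 * M) select s fun s' => Frame s s' ∧ ∃ b ∈ K, s'.mem 12 1 = (b : Fin n) ∧
      (r ≠ 0 → ∀ u ∈ K, G.nearCard u (r + 1) ≤ G.nearCard b (r + 1)) := by
  have hn := hB.le
  have hw := hB.word
  have hpos := hB.pos
  obtain ⟨lev, hl⟩ := hG.connected.exists_isLevel hne
  have hsplit : 1200 * M =
      200 * M + (100 * M + (100 * M + (200 * M + (200 * M + (100 * M + 300 * M))))) := by ring
  rw [hsplit]
  refine (runs_bfs hB hadj hl (by omega) hs hmark).seq ?_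
  rintro s₁ ⟨hf₁, hm₁, q, hq₁⟩
  have h11 : s₁.mem 11 = s.mem 11 := hm₁ 11 (by simp)
  have hmark₁ : Marks K (s₁.mem 11) := by rw [h11]; exact hmark
  refine (runs_accumulate hB hadj (by omega) (by omega) (hs.of_frame hf₁) hq₁.ordering ?_).seq ?_
  · rw [hmark₁.sum_eq]
    exact ncard_le_card _
  rintro s₂ ⟨hf₂, hm₂, h6⟩
  replace hf₂ := hf₁.trans hf₂
  have hq₂ := hq₁.congr (hm₂ 2 (by simp)) (hm₂ 5 (by simp))
  -- On level 1 this is the size of the projection; on higher levels it is 0, which `gatePass` reads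
  -- as having no candidate yet.
  have h6' : ∀ v : Fin n, s₂.mem 6 v = {u | G.Adj u v ∧ u ∈ K}.ncard := fun v => by
    rw [h6 v, hmark₁.sum_eq]
    congr 1
    ext u
    simp only [List.mem_toFinset, (hadj v).2, Set.mem_ofPred_eq, G.adj_comm v u]
  refine (runs_mapArray hB (by omega) (hs.of_frame hf₂) (fun v => (v : ℕ)) ?_ (T := 100)
    (by simp [Expr.cost])).seq ?_
  · intro v s' h1 _ _
    refine ⟨?_, h1⟩
    simp only [Expr.Fits, h1]
    omega
  rintro s₃ ⟨hf₃, hm₃, h7⟩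
  replace hf₃ := hf₂.trans hf₃
  have hq₃ := hq₂.congr (hm₃ 2 (by simp)) (hm₃ 5 (by simp))
  have h6₃ : ∀ v : Fin n, s₃.mem 6 v = {u | G.Adj u v ∧ u ∈ K}.ncard := fun v => by
    rw [hm₃ 6 (by simp)]
    exact h6' v
  refine (runs_gatePass hB hadj hG hl hK (hs.of_frame hf₃) hq₃ h7 ?_ ?_ ?_).seq ?_
  · intro v
    rw [h6₃ v]
    exact ncard_le_card _
  · intro v hv
    rw [h6₃ v, SimpleGraph.projCard]
    congr 1
    ext u
    simp only [Set.mem_ofPred_eq, hv, SimpleGraph.dist_eq_one_iff_adj]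
    exact and_comm
  · intro v hv
    rw [h6₃ v, Set.ncard_eq_zero (Set.toFinite _)]
    ext u
    simp only [Set.mem_ofPred_eq, Set.mem_empty_iff_false, iff_false, not_and]
    intro huv hu
    have h1 := hl.le_dist hG.connected hu v
    rw [SimpleGraph.dist_eq_one_iff_adj.2 huv] at h1
    omega
  rintro s₄ ⟨hf₄, hm₄, gate, h7₄, hgate⟩
  replace hf₄ := hf₃.trans hf₄
  have hq₄ := hq₃.congr (hm₄ 2 (by simp)) (hm₄ 5 (by simp))
  refine (runs_hitsPass hB (hs.of_frame hf₄) hq₄.levels hl.lt_card h7₄ (r := r) ?_ hrn).seq ?_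
  · rw [hf₄.reg 12 (by omega), hr]
  rintro s₅ ⟨hf₅, hm₅, h8⟩
  replace hf₅ := hf₄.trans hf₅
  have hq₅ := hq₄.congr (hm₅ 2 (by simp)) (hm₅ 5 (by simp))
  refine (runs_accumulate hB hadj (by omega) (by omega) (hs.of_frame hf₅) hq₅.ordering ?_).seq ?_
  · rw [Finset.sum_congr rfl fun x _ => h8 x, sum_card_filter_gate]
    exact ncard_le_card _
  rintro s₆ ⟨hf₆, hm₆, h9⟩
  replace hf₆ := hf₅.trans hf₆
  have h9' : ∀ u : Fin n, s₆.mem 9 u = {y | lev y = r ∧ G.Adj u (gate y)}.ncard := fun u => by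
    rw [h9 u, Finset.sum_congr rfl fun x _ => h8 x, sum_card_filter_gate]
    simp only [List.mem_toFinset, (hadj u).2]
  have hmark₆ : Marks K (s₆.mem 11) := by
    rw [hm₆ 11 (by simp), hm₅ 11 (by simp), hm₄ 11 (by simp), hm₃ 11 (by simp),
      hm₂ 11 (by simp)]
    exact hmark₁
  refine (runs_bestPass hB (hs.of_frame hf₆) hmark₆ hne ?_).mono (by omega) ?_
  · intro v
    rw [h9' v]
    exact ncard_le_card _
  rintro s₇ ⟨hf₇, b, hb, h12, hmax⟩
  refine ⟨hf₆.trans hf₇, b, hb, h12, fun hr0 u hu => ?_⟩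
  refine hl.nearCard_le_nearCard hG.connected hK hgate hr0 hu hb ?_
  rw [← h9' u, ← h9' b]
  exact hmax u hu

theorem dist_lt_card (hc : G.Connected) (u v : Fin n) : G.dist u v < n :=
  (hc.isLevel_singleton u).lt_card v

theorem runs_descend (hB : Bounds adj M W) (hadj : IsAdjacencyLists G adj)
    (hG : G.IsAlphaOneDeltaMetric) (hn2 : 2 ≤ n) {s : State} (hs : Holds adj M s) (p : Fin n)
    (hp : s.reg 10 = p) :
    Runs W (2000 * M) descend s fun s' => Holds adj M s' ∧
      (∀ r, r = 10 ∨ 14 ≤ r → s'.reg r = s.reg r) ∧ ∃ u : Fin n, s'.reg 13 = u ∧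
        (G.EccLE p (s'.reg 12) ∧ ∃ y, G.dist p y = s'.reg 12) ∧
        ((∃ y, 2 ≤ G.dist p y) → G.IsDescent p u) := by
  have hn := hB.le
  have hw := hB.word
  have hpos := hB.pos
  have hc := hG.connected
  have hsplit : 2000 * M = 605 * M + (6 * M + (100 * M + (1200 * M + 89 * M))) := by ring
  rw [hsplit]
  refine (runs_twoSearches hB hadj hc hs p hp).seq ?_
  rintro s₁ ⟨hs₁, hr₁, z, hz⟩
  have h3z := hz.dist_left z
  have hpz := dist_lt_card hc p z
  have hzn := z.2
  have hz11 := hz.reg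
  refine ((Program.runs_exec (W := W) (.assign 12 (.sub (.load 3 (.reg 11)) (.const 1))) s₁ ?_).mono
    (T' := 6 * M) ?_ fun _ h => h).seq ?_
  · simp only [Program.Fits, Expr.Fits, Expr.eval, hz11, h3z]
    omega
  · simp [Program.ticks, Expr.cost]
    omega
  rintro _ rfl
  simp only [Program.exec, Expr.eval, hz11, h3z, Nat.add_sub_cancel]
  set s₂ := s₁.setReg 12 (G.dist p z) with hs₂def
  have hs₂ : Holds adj M s₂ := hs₁.setReg (by omega) _
  have hr₂ : ∀ r, 10 ≤ r → r ≠ 11 → r ≠ 12 → s₂.reg r = s.reg r := by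
    intro r h1 h2 h3
    rw [hs₂def, State.setReg_reg, Function.update_of_ne h3, hr₁ r h1 h2]
  have hk : 1 ≤ G.dist p z := by
    have : Nontrivial (Fin n) := Fin.nontrivial_iff_two_le.2 hn2
    obtain ⟨y, hy⟩ := exists_ne p
    have h1 := hc.pos_dist_of_ne hy.symm
    have h2 := hz.far y
    omega
  obtain ⟨r, hr⟩ : ∃ r, G.dist p z = r + 1 := ⟨G.dist p z - 1, by omega⟩
  let K : Set (Fin n) := {u | G.Adj p u ∧ G.dist u z = r}
  -- A neighbour of `p` is at most one step nearer to `z`, so testing an inequality is enough.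
  have hKmem : ∀ v, v ∈ K ↔ G.dist p v = 1 ∧ G.dist z v + 1 ≤ G.dist z p := by
    intro v
    rw [SimpleGraph.dist_eq_one_iff_adj, G.dist_comm (u := z), G.dist_comm (u := z), hr]
    constructor
    · rintro ⟨h1, h2⟩
      exact ⟨h1, by omega⟩
    · rintro ⟨h1, h2⟩
      have := hc.dist_le_dist_add_one h1 z
      exact ⟨h1, by omega⟩
  have hKne : K.Nonempty := by
    obtain ⟨w, h1, h2⟩ := hc.exists_adj_dist_eq hr
    exact ⟨w, h1, h2⟩
  have hKclique : ∀ u ∈ K, ∀ v ∈ K, u ≠ v → G.Adj u v := by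
    rintro u ⟨hu, hu'⟩ v ⟨hv, hv'⟩ huv
    exact (hG.eq_or_adj_of_adj_of_adj hu hv hr hu' hv').resolve_left huv
  classical
  refine (runs_mapArray hB (by omega) hs₂ (fun v => if v ∈ K then 1 else 0) ?_ (T := 100)
    (by simp [Expr.cost, towardsTest])).seq ?_
  · intro v s' h1 hf hm
    have h10 : s'.reg 10 = p := by
      rw [hf.reg 10 (by omega), hr₂ 10 (by omega) (by omega) (by omega), hp]
    have h3 : s'.mem 3 v = G.dist p v + 1 := by
      rw [hm 3 (by simp)]
      exact hz.dist_left v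
    have h4 : s'.mem 4 v = G.dist z v + 1 := by
      rw [hm 4 (by simp)]
      exact hz.dist_right v
    have h4p : s'.mem 4 p = G.dist z p + 1 := by
      rw [hm 4 (by simp)]
      exact hz.dist_right p
    have d1 := dist_lt_card hc p v
    have d2 := dist_lt_card hc z v
    have d3 := dist_lt_card hc z p
    have hvn := v.2
    have hpn := p.2
    refine ⟨?_, ?_⟩
    · simp only [towardsTest, Expr.Fits, Expr.eval, h1, h3, h4, h10, h4p]
      omega
    · simp only [towardsTest, Expr.eval, h1, h3, h4, h10, h4p, hKmem v]
      split_ifs with hcond <;> omega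
  rintro s₃ ⟨hf₃, hm₃, h11⟩
  have hs₃ := hs₂.of_frame hf₃
  refine (runs_select hB hadj hG hKclique hKne hs₃ ?_ (r := r) ?_ (by omega)).seq ?_
  · intro v
    rw [h11 v]
    by_cases hv : v ∈ K <;> simp [hv]
  · rw [hf₃.reg 12 (by omega), hs₂def]
    simp [hr]
  rintro s₄ ⟨hf₄, b, hb, h12, hmax⟩
  have hf := hf₃.trans hf₄
  have hbn := b.2
  refine Program.runs_of_exec (by simp only [Program.Fits, Expr.Fits, Expr.eval, h12]; omega)
    (by simp [Program.ticks, Expr.cost]; omega) ⟨?_, ?_, b, ?_, ?_, ?_⟩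
  · exact (hs₂.of_frame hf).setReg (by omega) _
  · intro i hi
    simp only [Program.exec, State.setReg_reg]
    rw [Function.update_of_ne (by omega), hf.reg i (by omega),
      hr₂ i (by omega) (by omega) (by omega)]
  · simp [Program.exec, Expr.eval, h12]
  · have hreg : (Program.exec (.assign 13 (.load 12 (.const 1))) s₄).reg 12 = G.dist p z := by
      simp only [Program.exec, State.setReg_reg]
      rw [Function.update_of_ne (by omega), hf.reg 12 (by omega), hs₂def]
      simp
    rw [hreg]
    exact ⟨hz.far, z, rfl⟩
  -- A vertex at distance two excludes `r = 0`, the case in which the gate counts say nothing.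
  · rintro ⟨y, hy⟩
    have h1 := hz.far y
    refine ⟨z, hz.far, hb.1, by rw [hb.2, hr], fun u hu hu' => ?_⟩
    rw [hr] at hu' ⊢
    exact hmax (by omega) u ⟨hu, by omega⟩

end RAM

namespace RAM

variable {n : ℕ} {adj : Fin n → List (Fin n)} {M W : ℕ} {G : SimpleGraph (Fin n)}

/-! ## The starting vertex -/

/-- Is the vertex in the register `1` outside the middle of the shortest paths? -/
def offMiddle : Expr :=
  .add (.add (.sub (.add (.load 3 (.reg 1)) (.load 4 (.reg 1)))
        (.add (.load 3 (.reg 11)) (.const 1)))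
      (.sub (.add (.load 3 (.reg 11)) (.const 1)) (.add (.load 3 (.reg 1)) (.load 4 (.reg 1)))))
    (.add (.sub (.add (.reg 12) (.const 1)) (.add (.load 4 (.reg 1)) (.load 4 (.reg 1))))
      (.sub (.add (.load 4 (.reg 1)) (.load 4 (.reg 1))) (.add (.reg 12) (.const 2))))

/-- Finds a vertex of small eccentricity, and puts it into the registers `10` and `20`. -/
def start : Program :=
  .seq (.assign 10 (.const 0)) (.seq twoSearches
    (.seq (.assign 12 (.load 4 (.load 2 (.sub (.reg 0) (.const 1)))))
      (.seq (forVertices (.ifNonzero offMiddle .skip (.store 12 (.const 1) (.reg 1))))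
        (.seq (.assign 10 (.load 12 (.const 1)))
          (.seq (.assign 20 (.reg 10)) (.assign 21 (.reg 0)))))))

theorem runs_start (hB : Bounds adj M W) (hadj : IsAdjacencyLists G adj)
    (hG : G.IsAlphaOneDeltaMetric) (hn0 : 0 < n) {s : State} (hs : Holds adj M s) :
    Runs W (1000 * M) start s fun s' => Holds adj M s' ∧ ∃ m : Fin n, s'.reg 10 = m ∧
      s'.reg 20 = m ∧ s'.reg 21 = n ∧ ∀ R c, G.EccLE c R → G.EccLE m (R + 3) := by
  have hn := hB.le
  have hw := hB.word
  have hpos := hB.pos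
  have hc := hG.connected
  have hsplit : 1000 * M = 2 * M + (605 * M + (7 * M + (200 * M + 186 * M))) := by ring
  rw [hsplit]
  refine ((Program.runs_exec (W := W) (.assign 10 (.const 0)) s
    (by simp [Program.Fits, Expr.Fits])).mono (by simp [Program.ticks, Expr.cost]; omega)
    fun _ h => h).seq ?_
  rintro _ rfl
  set p : Fin n := ⟨0, hn0⟩ with hp
  refine (runs_twoSearches hB hadj hc (hs.setReg (r := 10) (by omega) 0) p
    (by simp [hp])).seq ?_
  rintro s₁ ⟨hs₁, -, z, hz⟩
  obtain ⟨w, hw2, hwfar⟩ := hz.last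
  have h0 := hs₁.reg
  have h4w := hz.dist_right w
  have hD := dist_lt_card hc z w
  have hwn := w.2
  refine ((Program.runs_exec (W := W)
    (.assign 12 (.load 4 (.load 2 (.sub (.reg 0) (.const 1))))) s₁ ?_).mono
    (T' := 7 * M) ?_ fun _ h => h).seq ?_
  · simp only [Program.Fits, Expr.Fits, Expr.eval, h0, hw2, h4w]
    omega
  · simp [Program.ticks, Expr.cost]
    omega
  rintro _ rfl
  simp only [Program.exec, Expr.eval, h0, hw2, h4w]
  set s₂ := s₁.setReg 12 (G.dist z w + 1) with hs₂def
  have hs₂ : Holds adj M s₂ := hs₁.setReg (by omega) _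
  have hz11 : s₂.reg 11 = z := by
    rw [hs₂def, State.setReg_reg, Function.update_of_ne (by omega), hz.reg]
  let good : Fin n → Prop := fun v => G.dist p v + G.dist z v = G.dist p z ∧
    G.dist z w ≤ 2 * G.dist z v ∧ 2 * G.dist z v ≤ G.dist z w + 1
  -- The rounded half of `d(z,w)` fits on the geodesic from `z` to `p`, because `d(z,w) ≤ d(z,p) +
  -- d(p,w) ≤ 2 d(z,p)`.
  have hgood : ∃ v, good v := by
    have h1 := hc.dist_triangle (u := z) (v := p) (w := w)
    have h2 := hz.far w
    obtain ⟨v, hv1, hv2⟩ := hc.exists_dist_eq_dist_add (u := z) (v := p) ((G.dist z w + 1) / 2)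
      (by rw [G.dist_comm (u := z) (v := p)] at h1 ⊢; omega)
    refine ⟨v, ?_, by omega, by omega⟩
    rw [G.dist_comm (u := p), G.dist_comm (u := p)]
    omega
  refine (runs_forVertices hB hs₂ (fun i μ => MemFrame [12] s₂.mem μ ∧
    ((∃ v, good v ∧ (v : ℕ) < i) → ∃ m : Fin n, good m ∧ μ 12 1 = m))
    ⟨fun _ _ => rfl, by simp⟩ ?_).mono (T' := 200 * M) ?_ (fun _ h => h) |>.seq ?_
  · rintro i hi s' ⟨hm, hinv⟩ h1 hf
    set v : Fin n := ⟨i, hi⟩ with hv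
    have r11 : s'.reg 11 = z := by rw [hf.reg 11 (by omega), hz11]
    have r12 : s'.reg 12 = G.dist z w + 1 := by
      rw [hf.reg 12 (by omega), hs₂def]
      simp
    have l3 : s'.mem 3 i = G.dist p v + 1 := by
      rw [hm 3 (by simp)]
      exact hz.dist_left v
    have l4 : s'.mem 4 i = G.dist z v + 1 := by
      rw [hm 4 (by simp)]
      exact hz.dist_right v
    have l3z : s'.mem 3 z = G.dist p z + 1 := by
      rw [hm 3 (by simp)]
      exact hz.dist_left z
    have d1 := dist_lt_card hc p v
    have d2 := dist_lt_card hc z v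
    have d3 := dist_lt_card hc p z
    have hzn := z.2
    have hfits : offMiddle.Fits W s' := by
      simp only [offMiddle, Expr.Fits, Expr.eval, h1, r11, r12, l3, l4, l3z]
      omega
    -- All stored distances and the register `12` are one too large; the constants in `offMiddle`
    -- compensate for this.
    have heval : offMiddle.eval s' = 0 ↔ good v := by
      simp only [offMiddle, Expr.eval, h1, r11, r12, l3, l4, l3z, good]
      omega
    by_cases hgv : good v
    · have hexec : Program.exec (.ifNonzero offMiddle .skip (.store 12 (.const 1) (.reg 1))) s' =
          s'.setMem 12 1 i := by
        simp [Program.exec, heval.2 hgv, Expr.eval, h1]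
      rw [hexec]
      refine ⟨⟨hfits, fun _ => trivial, fun _ => ?_⟩, rfl, rfl, rfl, ?_, fun _ => ⟨v, hgv, ?_⟩⟩
      · simp only [Program.Fits, Expr.Fits, h1]
        omega
      · intro a ha
        rw [← hm a ha]
        simp only [List.mem_singleton] at ha
        simp [ha]
      · simp [hv]
    · have hne := mt heval.1 hgv
      have hexec : Program.exec (.ifNonzero offMiddle .skip (.store 12 (.const 1) (.reg 1))) s' =
          s' := by
        simp [Program.exec, hne]
      rw [hexec]
      refine ⟨⟨hfits, fun _ => trivial, fun h => absurd h hne⟩, rfl, rfl, rfl, hm, ?_⟩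
      rintro ⟨x, hx, hxi⟩
      rcases Nat.lt_succ_iff_lt_or_eq.1 hxi with g | g
      · exact hinv ⟨x, hx, g⟩
      · exact absurd ((Fin.ext g : x = v) ▸ hx) hgv
  · simp only [offMiddle, Program.ticks, Expr.cost]
    omega
  rintro s₃ ⟨hf₃, hm₃, hinv⟩
  obtain ⟨v, hv⟩ := hgood
  obtain ⟨m, ⟨g1, g2, g3⟩, hm12⟩ := hinv ⟨v, hv, v.2⟩
  have hs₃ := hs₂.of_frame hf₃
  have h0₃ := hs₃.reg
  have hmn := m.2
  refine Program.runs_of_exec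
    (P := .seq (.assign 10 (.load 12 (.const 1))) (.seq (.assign 20 (.reg 10)) (.assign 21 (.reg 0))))
    ?_ (by simp [Program.ticks, Expr.cost]; omega) ⟨?_, m, ?_, ?_, ?_, ?_⟩
  · simp [Program.Fits, Program.exec, Expr.Fits, Expr.eval, hm12, h0₃]
    omega
  · exact ((hs₃.setReg (by omega) _).setReg (by omega) _).setReg (by omega) _
  · simp [Program.exec, Expr.eval, hm12]
  · simp [Program.exec, Expr.eval, hm12]
  · simp [Program.exec, Expr.eval, h0₃]
  · intro R c hcR
    rw [G.dist_comm (u := p), G.dist_comm (u := p)] at g1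
    exact hG.eccLE_of_midpoint hz.far hwfar ⟨w, rfl⟩ (by rw [G.dist_comm (u := m)] at *; omega)
      g2 g3 hcR

/-! ## The main program -/

/-- A step of the descent that keeps track of the best vertex seen, which is in the register `20`,
and of its eccentricity, which is in the register `21`. -/
def improve : Program :=
  .seq descend (.seq (.ifNonzero (.sub (.reg 21) (.reg 12))
    (.seq (.assign 20 (.reg 10)) (.assign 21 (.reg 12))) .skip) (.assign 10 (.reg 13)))

/-- Repeats a program. -/
def Program.iterate (P : Program) : ℕ → Program
  | 0 => .skip
  | k + 1 => .seq (P.iterate k) P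

/-- After `k` steps of the descent through the vertices `f 0, …, f k`. -/
structure Descended (G : SimpleGraph (Fin n)) (adj : Fin n → List (Fin n)) (M : ℕ) (p : Fin n)
    (k : ℕ) (f : ℕ → Fin n) (s : State) : Prop where
  holds : Holds adj M s
  zero : f 0 = p
  last : s.reg 10 = f k
  step : ∀ i < k, (∃ y, 2 ≤ G.dist (f i) y) → G.IsDescent (f i) (f (i + 1))
  best : ∃ b : Fin n, s.reg 20 = b ∧ G.EccLE b (s.reg 21)
  best_lt : s.reg 21 ≤ n
  best_le : ∀ i < k, ∀ r, G.EccLE (f i) r → s.reg 21 ≤ r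

theorem runs_improve (hB : Bounds adj M W) (hadj : IsAdjacencyLists G adj)
    (hG : G.IsAlphaOneDeltaMetric) (hn2 : 2 ≤ n) {p : Fin n} {k : ℕ} {f : ℕ → Fin n} {s : State}
    (hs : Descended G adj M p k f s) :
    Runs W (2100 * M) improve s fun s' => ∃ f, Descended G adj M p (k + 1) f s' := by
  have hn := hB.le
  have hw := hB.word
  have hpos := hB.pos
  have hsplit : 2100 * M = 2000 * M + 100 * M := by ring
  rw [hsplit]
  refine (runs_descend hB hadj hG hn2 hs.holds (f k) hs.last).seq ?_
  rintro s₁ ⟨hs₁, hr₁, u, h13, ⟨hecc, y, hy⟩, hdesc⟩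
  have h12 := dist_lt_card hG.connected (f k) y
  rw [hy] at h12
  have h10 : s₁.reg 10 = f k := (hr₁ 10 (by omega)).trans hs.last
  have h20 := hr₁ 20 (by omega)
  have h21 := hr₁ 21 (by omega)
  have hle := hs.best_lt
  have hun := u.2
  have hfk := (f k).2
  have hlow : ∀ r, G.EccLE (f k) r → s₁.reg 12 ≤ r := fun r hr => hy ▸ hr y
  have hfun : ∀ i ≤ k, Function.update f (k + 1) u i = f i := fun i hi =>
    Function.update_of_ne (by omega) _ _
  have hstep : ∀ i < k + 1, (∃ y, 2 ≤ G.dist (Function.update f (k + 1) u i) y) →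
      G.IsDescent (Function.update f (k + 1) u i) (Function.update f (k + 1) u (i + 1)) := by
    intro i hi h
    rw [hfun i (by omega)] at h ⊢
    rcases Nat.lt_succ_iff_lt_or_eq.1 hi with g | rfl
    · rw [hfun (i + 1) (by omega)]
      exact hs.step i g h
    · rw [Function.update_self]
      exact hdesc h
  have hzero : Function.update f (k + 1) u 0 = p := (hfun 0 (by omega)).trans hs.zero
  by_cases hc : s₁.reg 12 < s₁.reg 21
  · have e1 : s₁.reg 21 - s₁.reg 12 ≠ 0 := by omega
    have hexec : Program.exec (.seq (.ifNonzero (.sub (.reg 21) (.reg 12))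
        (.seq (.assign 20 (.reg 10)) (.assign 21 (.reg 12))) .skip) (.assign 10 (.reg 13))) s₁ =
        ((s₁.setReg 20 (f k)).setReg 21 (s₁.reg 12)).setReg 10 u := by
      simp [Program.exec, Expr.eval, e1, h10, h13]
    refine Program.runs_of_exec ?_ (by simp [Program.ticks, Expr.cost]; omega)
      ⟨Function.update f (k + 1) u, ?_⟩
    · simp [Program.Fits, Program.exec, Expr.Fits, Expr.eval, e1, h10, h13]
      omega
    rw [hexec]
    refine ⟨((hs₁.setReg (by omega) _).setReg (by omega) _).setReg (by omega) _, hzero,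
      by simp, hstep, ⟨f k, by simp, by simpa using hecc⟩, by simp; omega, ?_⟩
    intro i hi r hr
    rw [hfun i (by omega)] at hr
    simp only [State.setReg_reg, ne_eq, Nat.reduceEqDiff, not_false_eq_true,
      Function.update_of_ne, Function.update_self]
    rcases Nat.lt_succ_iff_lt_or_eq.1 hi with g | rfl
    · have := hs.best_le i g r hr
      omega
    · exact hlow r hr
  · have e1 : s₁.reg 21 - s₁.reg 12 = 0 := by omega
    have hexec : Program.exec (.seq (.ifNonzero (.sub (.reg 21) (.reg 12))
        (.seq (.assign 20 (.reg 10)) (.assign 21 (.reg 12))) .skip) (.assign 10 (.reg 13))) s₁ =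
        s₁.setReg 10 u := by
      simp [Program.exec, Expr.eval, e1, h13]
    refine Program.runs_of_exec ?_ (by simp [Program.ticks, Expr.cost]; omega)
      ⟨Function.update f (k + 1) u, ?_⟩
    · simp [Program.Fits, Program.exec, Expr.Fits, Expr.eval, e1, h13]
      omega
    rw [hexec]
    refine ⟨hs₁.setReg (by omega) _, hzero, by simp, hstep, ?_, by simp; omega, ?_⟩
    · simpa [h20, h21] using hs.best
    intro i hi r hr
    rw [hfun i (by omega)] at hr
    simp only [State.setReg_reg, ne_eq, Nat.reduceEqDiff, not_false_eq_true,
      Function.update_of_ne]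
    rcases Nat.lt_succ_iff_lt_or_eq.1 hi with g | rfl
    · have := hs.best_le i g r hr
      omega
    · have := hlow r hr
      omega

theorem runs_iterate_improve (hB : Bounds adj M W) (hadj : IsAdjacencyLists G adj)
    (hG : G.IsAlphaOneDeltaMetric) (hn2 : 2 ≤ n) {p : Fin n} {f : ℕ → Fin n} {s : State}
    (hs : Descended G adj M p 0 f s) (k : ℕ) :
    Runs W ((2100 * k + 1) * M) (improve.iterate k) s
      fun s' => ∃ f, Descended G adj M p k f s' := by
  induction k with
  | zero =>
    have := hB.pos
    exact Program.runs_of_exec (P := .skip) trivial (by simpa [Program.ticks] using this) ⟨f, hs⟩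
  | succ k ih =>
    have hsplit : (2100 * (k + 1) + 1) * M = (2100 * k + 1) * M + 2100 * M := by ring
    rw [hsplit]
    refine ih.seq ?_
    rintro s' ⟨f, hf⟩
    exact runs_improve hB hadj hG hn2 hf

/-- Finds a central vertex. -/
def centralVertex : Program :=
  .ifNonzero (.sub (.reg 0) (.const 1))
    (.seq start (.seq (improve.iterate 7) (.assign 0 (.reg 20)))) (.assign 0 (.const 0))

/-- The register `21` always bounds the eccentricity of the remembered vertex and ends up at most
the radius, so that vertex is central. A single vertex is treated apart, since a descent needs a
neighbour. -/
theorem runs_centralVertex (hB : Bounds adj M W) (hadj : IsAdjacencyLists G adj)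
    (hG : G.IsAlphaOneDeltaMetric) {s : State} (hs : Holds adj M s) :
    Runs W (20000 * M) centralVertex s fun s' => ∃ c ∈ G.center, s'.reg 0 = (c : Fin n) := by
  have hn := hB.le
  have hw := hB.word
  have hpos := hB.pos
  have hc := hG.connected
  have hn0 : 0 < n := (hc.nonempty.some).pos
  have h0 := hs.reg
  rcases Nat.lt_or_ge n 2 with hlt | hn2
  · have e0 : (Expr.sub (.reg 0) (.const 1)).eval s = 0 := by
      simp only [Expr.eval, h0]
      omega
    obtain ⟨t, s', h1, h2, rfl⟩ := Program.runs_exec (W := W) (.assign 0 (.const 0)) s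
      (by simp [Program.Fits, Expr.Fits])
    refine ⟨_, _, .ifFalse ?_ e0 h1, ?_, ⟨0, hn0⟩, ?_, ?_⟩
    · simp only [Expr.Fits, h0]
      omega
    · simp only [Expr.cost]
      simp only [Program.ticks, Expr.cost] at h2
      omega
    · refine hG.mem_center_of_eccLE (R := 0) (fun y => ?_) (fun _ _ _ => Nat.zero_le _)
      have : y = ⟨0, hn0⟩ := Fin.ext (by have := y.2; simp only; omega)
      rw [this, SimpleGraph.dist_self]
    · simp [Program.exec, Expr.eval]
  have e0 : (Expr.sub (.reg 0) (.const 1)).eval s ≠ 0 := by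
    simp only [Expr.eval, h0]
    omega
  suffices h : Runs W (19000 * M) (.seq start (.seq (improve.iterate 7) (.assign 0 (.reg 20)))) s
      fun s' => ∃ c ∈ G.center, s'.reg 0 = (c : Fin n) by
    obtain ⟨t, s', h1, h2, h3⟩ := h
    refine ⟨_, s', .ifTrue ?_ e0 h1, ?_, h3⟩
    · simp only [Expr.Fits, h0]
      omega
    · simp only [Expr.cost]
      omega
  have hsplit : 19000 * M = 1000 * M + ((2100 * 7 + 1) * M + 3299 * M) := by ring
  rw [hsplit]
  refine (runs_start hB hadj hG hn0 hs).seq ?_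
  rintro s₁ ⟨hs₁, m, h10, h20, h21, hm⟩
  refine (runs_iterate_improve hB hadj hG hn2 (p := m) (f := fun _ => m) ⟨hs₁, rfl, h10, ?_,
    ⟨m, h20, ?_⟩, h21.le, ?_⟩ 7).seq ?_
  · intro i hi
    omega
  · intro y
    rw [h21]
    exact (dist_lt_card hc m y).le
  · intro i hi
    omega
  rintro s₂ ⟨f, hf⟩
  obtain ⟨b, hb, hbe⟩ := hf.best
  have hbn := b.2
  refine Program.runs_of_exec (by simp only [Program.Fits, Expr.Fits, hb]; omega)
    (by simp [Program.ticks, Expr.cost]; omega) ⟨b, ?_, by simp [Program.exec, Expr.eval, hb]⟩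
  classical
  have hex : ∃ R, ∃ c, G.EccLE c R := ⟨n, m, fun y => (dist_lt_card hc m y).le⟩
  obtain ⟨c, hcR⟩ := Nat.find_spec hex
  have hmin : ∀ v r, G.EccLE v r → Nat.find hex ≤ r := fun v r h => Nat.find_min' hex ⟨v, h⟩
  set R := Nat.find hex with hR
  have hR1 : 1 ≤ R := by
    have : Nontrivial (Fin n) := Fin.nontrivial_iff_two_le.2 hn2
    obtain ⟨y, hy⟩ := exists_ne c
    have h1 := hc.pos_dist_of_ne hy.symm
    have h2 := hcR y
    omega
  -- Some vertex among `f 0, …, f 6` has eccentricity at most `R`. Round `i + 1` evaluates `f i`,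
  -- which is why six steps need seven rounds.
  have hle : s₂.reg 21 ≤ R := by
    obtain ⟨i, hi, hiR⟩ := hG.exists_eccLE_of_descents hR1 hcR hf.step
      (by rw [hf.zero]; exact hm R c hcR)
    exact hf.best_le i (by omega) R hiR
  exact hG.mem_center_of_eccLE (fun y => (hbe y).trans hle) hmin

end RAM

/-! ## The input -/

theorem IsAdjacencyLists.sum_length {n : ℕ} {G : SimpleGraph (Fin n)} {adj : Fin n → List (Fin n)}
    (hadj : IsAdjacencyLists G adj) : ∑ v, (adj v).length = 2 * G.edgeSet.ncard := by
  classical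
  have h := G.sum_degrees_eq_twice_card_edges
  rw [← SimpleGraph.coe_edgeFinset, Set.ncard_coe_finset, ← h]
  refine Finset.sum_congr rfl fun v _ => ?_
  rw [← List.toFinset_card_of_nodup (hadj v).1, ← SimpleGraph.card_neighborFinset_eq_degree]
  congr 1
  ext u
  simp [(hadj v).2]

namespace RAM

variable {n : ℕ} {adj : Fin n → List (Fin n)}

theorem holds_inputState {M : ℕ} (hM : ∑ v, (adj v).length ≤ 2 * M) :
    Holds adj M (inputState adj) := by
  have hoff : ∀ i ≤ n, (inputState adj).mem 0 i =
      (((List.finRange n).take i).map fun v => (adj v).length).sum := fun i hi => by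
    simp [inputState, hi]
  refine ⟨by simp [inputState], ?_, ?_, ?_⟩
  · intro v
    rw [hoff _ v.2, hoff _ v.2.le, List.take_succ_eq_append_getElem (by simp), List.map_append,
      List.sum_append]
    simp
  · intro i hi
    rw [hoff i hi]
    refine le_trans ?_ hM
    rw [← List.sum_toFinset _ ((List.nodup_finRange n).sublist (List.take_sublist _ _))]
    exact Finset.sum_le_sum_of_subset (Finset.subset_univ _)
  · intro v j hj
    rw [hoff _ v.2.le]
    have hsplit : List.finRange n =
        (List.finRange n).take v ++ v :: (List.finRange n).drop (v + 1) := by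
      conv_lhs => rw [← List.take_append_drop v (List.finRange n)]
      rw [List.drop_eq_getElem_cons (by simp)]
      simp
    have hlists : (List.finRange n).flatMap adj =
        ((List.finRange n).take v).flatMap adj ++
          (adj v ++ ((List.finRange n).drop (v + 1)).flatMap adj) := by
      rw [← List.flatMap_cons, ← List.flatMap_append, ← hsplit]
    have hlen : (((List.finRange n).take v).map fun v => (adj v).length).sum =
        ((((List.finRange n).take v).flatMap adj).map Fin.val).length := by
      simp [List.length_flatMap]
    have hmem : ∀ i, (inputState adj).mem 1 i =
        (((List.finRange n).flatMap adj).map Fin.val).getD i 0 := fun i => by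
      simp [inputState, List.map_eq_flatMap,
        List.bind_eq_flatMap, List.pure_def, List.flatMap_assoc]
    rw [hmem, hlen, hlists, List.map_append, List.map_append,
      List.getD_append_right _ _ _ _ (by omega), Nat.add_sub_cancel_left,
      List.getD_append _ _ _ _ (by simpa using hj), List.getD_eq_getElem _ _ (by simpa using hj)]
    simp

/-- Connectedness gives at most `m + 1` vertices, so one parameter controls both the vertices and
the adjacency lists. -/
theorem bounds_of_connected {G : SimpleGraph (Fin n)} (hc : G.Connected)
    (hadj : IsAdjacencyLists G adj) {W : ℕ} (hW : 10 * (G.edgeSet.ncard + 1) ≤ W) :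
    Bounds adj (G.edgeSet.ncard + 1) W where
  pos := by omega
  le := by
    have h := hc.card_vert_le_card_edgeSet_add_one
    rw [Nat.card_eq_fintype_card, Fintype.card_fin] at h
    rwa [Set.ncard]
  sum_le := by rw [hadj.sum_length]; omega
  word := hW

end RAM

theorem mainTheorem9 :
    ∃ (P : RAM.Program) (C : ℕ), ∀ (n : ℕ) (G : SimpleGraph (Fin n)) (adj : Fin n → List (Fin n)),
      G.IsAlphaOneDeltaMetric → IsAdjacencyLists G adj →
        ∃ (t : ℕ) (s : RAM.State),
          RAM.Exec (C * (G.edgeSet.ncard + 1)) P (inputState adj) t s ∧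
          t ≤ C * (G.edgeSet.ncard + 1) ∧
          ∃ c ∈ G.center, s.reg 0 = (c : ℕ) := by
  -- The constant is dictated by the running time; a factor of 10 would do for the word bound.
  refine ⟨RAM.centralVertex, 20000, fun n G adj hG hadj => ?_⟩
  exact RAM.runs_centralVertex
    (RAM.bounds_of_connected hG.connected hadj (Nat.mul_le_mul_right _ (by norm_num))) hadj hG
    (RAM.holds_inputState (by rw [hadj.sum_length]; omega))
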